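/- Let $n\ge 0$ be an integer and let $$\mathcal H^P_n=\left\{\begin{pmatrix}X&Y\\-\overline Y&\overline X\end{pmatrix} : X,Y\in \mathrm{Mat}(\mathbb C,n)\right\}\subset \mathrm{Mat}(\mathbb C,2n),$$ regarded as a real algebra of real dimension $4n^2$. Say that $A\in\mathcal H^P_n$ has a purely imaginary spectrum if every eigenvalue $\lambda\in\mathbb C$ of the $2n\times 2n$ matrix $A$ satisfies $\operatorname{Re}\lambda=0$ (the eigenvalue $0$ is allowed). Then the set of all $A\in\mathcal H^P_n$ with a purely imaginary spectrum is the disjoint union of finitely many non-empty smooth embedded submanifolds of $\mathcal H^P_n$, each of them of constant dimension and invariant under conjugation by the invertible elements of $\mathcal H^P_n$. Exactly one of these submanifolds has real dimension $4n^2-n$, and all the others have strictly smaller dimension. The one of dimension $4n^2-n$ consists exactly of those $A\in\mathcal H^P_n$ with a purely imaginary spectrum that have no repeated eigenvalues, i.e. whose $2n$ eigenvalues, counted with algebraic multiplicity, are pairwise distinct. -/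

import Mathlib

open scoped ContDiff

/- All norms on a finite-dimensional space are equivalent, so the choice of a norm on matrices does
not affect smoothness or the topology; the operator norm makes them a normed algebra. -/
attribute [local instance] Matrix.linftyOpNormedRing Matrix.linftyOpNormedAlgebra

/-- The complex model of the quaternionic `n × n` matrices: the real subalgebra of `Mat(ℂ, 2n)` of
all block matrices with rows `(X, Y)` and `(-conj Y, conj X)`, for `X, Y ∈ Mat(ℂ, n)`. -/
def QuatMat (n : ℕ) : Subalgebra ℝ (Matrix (Fin n ⊕ Fin n) (Fin n ⊕ Fin n) ℂ) where
  carrier := {Z | ∃ X Y : Matrix (Fin n) (Fin n) ℂ,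
    Z = Matrix.fromBlocks X Y (-(Y.map (starRingEnd ℂ))) (X.map (starRingEnd ℂ))}
  mul_mem' := by
    rintro _ _ ⟨X, Y, rfl⟩ ⟨X', Y', rfl⟩
    refine ⟨X * X' - Y * Y'.map (starRingEnd ℂ), X * Y' + Y * X'.map (starRingEnd ℂ), ?_⟩
    have hc : ∀ M : Matrix (Fin n) (Fin n) ℂ,
        (M.map (starRingEnd ℂ)).map (starRingEnd ℂ) = M := by
      intro M; ext i j; simp
    rw [Matrix.fromBlocks_multiply, Matrix.map_sub _ (map_sub _), Matrix.map_add _ (map_add _),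
      Matrix.map_mul, Matrix.map_mul, Matrix.map_mul, Matrix.map_mul, hc, hc]
    congr 1 <;> noncomm_ring
  add_mem' := by
    rintro _ _ ⟨X, Y, rfl⟩ ⟨X', Y', rfl⟩
    refine ⟨X + X', Y + Y', ?_⟩
    rw [Matrix.fromBlocks_add, Matrix.map_add _ (map_add _), Matrix.map_add _ (map_add _), neg_add]
  algebraMap_mem' := by
    intro r
    refine ⟨algebraMap ℝ _ r, 0, ?_⟩
    ext i j
    rcases i with i | i <;> rcases j with j | j <;>
      by_cases h : i = j <;> simp [Matrix.algebraMap_matrix_apply, h]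

/-- All eigenvalues in `ℂ` lie on the imaginary axis (the eigenvalue `0` is allowed). -/
def HasPurelyImaginarySpectrum {n : ℕ} (A : QuatMat n) : Prop :=
  ∀ z ∈ spectrum ℂ (A : Matrix (Fin n ⊕ Fin n) (Fin n ⊕ Fin n) ℂ), z.re = 0

/-- The `2n` eigenvalues, counted with algebraic multiplicity, are pairwise distinct. -/
def HasNoRepeatedEigenvalues {n : ℕ} (A : QuatMat n) : Prop :=
  (Matrix.charpoly (A : Matrix (Fin n ⊕ Fin n) (Fin n ⊕ Fin n) ℂ)).roots.Nodup

/-- Invariance under conjugation by the invertible elements of the algebra `QuatMat n`. -/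
def IsConjugacyInvariant {n : ℕ} (S : Set (QuatMat n)) : Prop :=
  ∀ (C : (QuatMat n)ˣ), ∀ A ∈ S, (C : QuatMat n) * A * ((C⁻¹ : (QuatMat n)ˣ) : QuatMat n) ∈ S

/-- `S` is an embedded smooth submanifold of dimension `d` of the finite-dimensional real vector
space `E`: around each of its points there is a smooth chart of `E` (a diffeomorphism between open
subsets of `E`) that turns `S` into a linear subspace of dimension `d`. -/
def IsEmbeddedSubmanifold {E : Type*} [NormedAddCommGroup E] [NormedSpace ℝ E]
    [FiniteDimensional ℝ E] (d : ℕ) (S : Set E) : Prop :=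
  ∀ x ∈ S, ∃ (φ : OpenPartialHomeomorph E E) (V : Submodule ℝ E),
    x ∈ φ.source ∧ ContDiffOn ℝ ∞ φ φ.source ∧ ContDiffOn ℝ ∞ φ.symm φ.target ∧
    Module.finrank ℝ V = d ∧ ∀ y ∈ φ.source, y ∈ S ↔ φ y ∈ V

/-! Write `𝔸` for `QuatMat n`. Two independent arguments are combined: a conjugation chart for
matrices with simple spectrum, and a stratification of real semialgebraic sets for the others.

Building a flag of quaternionic lines from eigenvectors shows that every `A` is conjugate in `𝔸` to
a triangular `T` (`exists_conj_blockTriangular`). Its diagonal consists of `n` pairs `λ`, `conj λ`,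
so a purely imaginary spectrum amounts to `n` real equations `Re λ = 0`. If the eigenvalues are
distinct, the commutator with `T` is injective modulo the triangular subalgebra. Then conjugates of
triangular matrices by `1 + N`, with `N` in a complement of this subalgebra, fill a neighbourhood
diffeomorphically (`isEmbeddedAt_conj`), and the simple-spectrum part has codimension `n`.

Both spectral conditions are also polynomial in `A`. The numbers `(λ + μ)²`, over all pairs of
eigenvalues, are the roots of a polynomial whose coefficients have nonnegative real parts exactly
when the spectrum is imaginary. A coefficient of the polynomial with roots `λ - μ` detects
repetition. The repeated-eigenvalue part is therefore an invariant algebraic set restricted by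
invariant inequalities `c ≥ 0`. A real algebraic set is smooth where the differentials of its
equations have maximal rank (`isEmbeddedAt_of_corank_max`); the remaining points form a smaller
algebraic set, and Noetherian induction gives finitely many strata, invariant because the rank is.

Every stratum of the repeated part is small by Hausdorff dimension: it is covered by conjugates of
triangular matrices obeying `n + 1` independent linear conditions, and conjugation adds at most the
codimension of the triangular subalgebra (`dimH_conjugates_le`). -/

section

open Set Filter Topology ComplexConjugate
open scoped Kronecker

/-! ### Charts, embedded submanifolds and Hausdorff dimension -/

section LocalCharts

variable {E : Type*} [NormedAddCommGroup E] [NormedSpace ℝ E]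

/-- A smooth map with invertible derivative at a point restricts to a diffeomorphism between open
sets. -/
theorem exists_openPartialHomeomorph_of_contDiffOn [FiniteDimensional ℝ E] {f : E → E}
    {U : Set E} {a : E}
    (hU : IsOpen U) (ha : a ∈ U) (hf : ContDiffOn ℝ ∞ f U) {f' : E ≃L[ℝ] E}
    (hf' : HasFDerivAt f (f' : E →L[ℝ] E) a) :
    ∃ φ : OpenPartialHomeomorph E E, a ∈ φ.source ∧ φ.source ⊆ U ∧ (∀ x, φ x = f x) ∧
      ContDiffOn ℝ ∞ φ φ.source ∧ ContDiffOn ℝ ∞ φ.symm φ.target := by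
  have : CompleteSpace E := FiniteDimensional.complete ℝ E
  have hfa : ContDiffAt ℝ ∞ f a := hf.contDiffAt (hU.mem_nhds ha)
  set e := hfa.toOpenPartialHomeomorph f hf' (by simp) with he
  have hcont : ContinuousOn (fderiv ℝ f) U := hf.continuousOn_fderiv_of_isOpen hU (by simp)
  -- Restricting to points with invertible derivative makes the inverse smooth on the whole target,
  -- not only at `f a`.
  set W : Set E := U ∩ fderiv ℝ f ⁻¹' (range ((↑) : (E ≃L[ℝ] E) → E →L[ℝ] E)) with hW
  have hWo : IsOpen W := hcont.isOpen_inter_preimage hU (ContinuousLinearEquiv.isOpen)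
  have haW : a ∈ W := ⟨ha, f', hf'.fderiv.symm⟩
  refine ⟨e.restrOpen W hWo, ?_, ?_, fun x => rfl, ?_, ?_⟩
  · exact ⟨hfa.mem_toOpenPartialHomeomorph_source hf' (by simp), haW⟩
  · exact fun x hx => hx.2.1
  · exact hf.mono fun x hx => hx.2.1
  · intro y hy
    apply ContDiffAt.contDiffWithinAt
    have hys := (e.restrOpen W hWo).map_target hy
    obtain ⟨-, hyU, g, hg⟩ := hys
    have hfy : ContDiffAt ℝ ∞ f ((e.restrOpen W hWo).symm y) := hf.contDiffAt (hU.mem_nhds hyU)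
    refine (e.restrOpen W hWo).contDiffAt_symm (f₀' := g) hy ?_ hfy
    rw [hg]
    exact (hfy.differentiableAt (by simp)).hasFDerivAt

/-- Local form of being an embedded submanifold of dimension `d`. -/
def IsEmbeddedAt (d : ℕ) (S : Set E) (x : E) : Prop :=
  ∃ (φ : OpenPartialHomeomorph E E) (V : Submodule ℝ E),
    x ∈ φ.source ∧ ContDiffOn ℝ ∞ φ φ.source ∧ ContDiffOn ℝ ∞ φ.symm φ.target ∧
    Module.finrank ℝ V = d ∧ ∀ y ∈ φ.source, y ∈ S ↔ φ y ∈ V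

theorem IsEmbeddedAt.congr {d : ℕ} {S T : Set E} {x : E} (h : IsEmbeddedAt d S x)
    (hST : ∀ᶠ y in 𝓝 x, y ∈ S ↔ y ∈ T) : IsEmbeddedAt d T x := by
  obtain ⟨φ, V, hx, h1, h2, h3, h4⟩ := h
  obtain ⟨W, hW, hWo, hxW⟩ := eventually_nhds_iff.1 hST
  refine ⟨φ.restrOpen W hWo, V, ⟨hx, hxW⟩, h1.mono fun y hy => hy.1, h2.mono fun y hy => hy.1,
    h3, fun y hy => ?_⟩
  rw [← hW y hy.2]
  exact h4 y hy.1

/-- A local diffeomorphism onto a neighbourhood parametrizing `S` by a linear subspace. -/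
theorem isEmbeddedAt_of_parametrization [FiniteDimensional ℝ E] {f : E → E} {U : Set E} {a : E}
    {S : Set E}
    (hU : IsOpen U) (ha : a ∈ U) (hf : ContDiffOn ℝ ∞ f U) {f' : E ≃L[ℝ] E}
    (hf' : HasFDerivAt f (f' : E →L[ℝ] E) a) (V : Submodule ℝ E)
    (hS : ∀ x ∈ U, f x ∈ S ↔ x ∈ V) : IsEmbeddedAt (Module.finrank ℝ V) S (f a) := by
  obtain ⟨φ, h1, h2, h3, h4, h5⟩ := exists_openPartialHomeomorph_of_contDiffOn hU ha hf hf'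
  refine ⟨φ.symm, V, ?_, h5, h4, rfl, fun y hy => ?_⟩
  · rw [← h3]; exact φ.map_source h1
  · have := hS _ (h2 (φ.map_target hy))
    rwa [← h3, φ.right_inv hy] at this

theorem dimH_image_le_finrank {W : Type*} [NormedAddCommGroup W] [NormedSpace ℝ W]
    [FiniteDimensional ℝ W] {f : W → E} {s t : Set W} (hf : ContDiffOn ℝ 1 f s)
    (hc : Convex ℝ s) (ht : t ⊆ s) : dimH (f '' t) ≤ Module.finrank ℝ W :=
  (hf.dimH_image_le hc ht).trans
    ((dimH_mono (subset_univ _)).trans (Real.dimH_univ_eq_finrank W).le)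

/-- A continuously differentiable chart on a ball does not raise Hausdorff dimension, and the image
of `S` contains a neighbourhood of a point in `V`. Hence upper bounds on `dimH S` bound `d`. -/
theorem IsEmbeddedAt.le_dimH [FiniteDimensional ℝ E] {d : ℕ} {S : Set E} {x : E}
    (h : IsEmbeddedAt d S x) (hx : x ∈ S) :
    (d : ENNReal) ≤ dimH S := by
  obtain ⟨φ, V, hxs, h1, h2, rfl, h4⟩ := h
  obtain ⟨ε, hε, hball⟩ := Metric.isOpen_iff.1 φ.open_source x hxs
  have hV : φ x ∈ V := (h4 x hxs).1 hx
  have hs : dimH (φ '' (Metric.ball x ε ∩ S)) ≤ dimH S :=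
    ((h1.mono hball).of_le (by simp)).dimH_image_le (convex_ball x ε) inter_subset_left
      |>.trans (dimH_mono inter_subset_right)
  refine le_trans ?_ hs
  have hopen : IsOpen (φ '' (Metric.ball x ε)) :=
    φ.isOpen_image_of_subset_source Metric.isOpen_ball hball
  have hpre : ((↑) : V → E) ⁻¹' (φ '' (Metric.ball x ε)) ∈ 𝓝 (⟨φ x, hV⟩ : V) :=
    (hopen.preimage continuous_subtype_val).mem_nhds ⟨x, Metric.mem_ball_self hε, rfl⟩
  rw [← Real.dimH_of_mem_nhds hpre, ← (isometry_subtype_coe (s := (V : Set E))).dimH_image]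
  apply dimH_mono
  rintro _ ⟨v, ⟨y, hy, hyv⟩, rfl⟩
  exact ⟨y, ⟨hy, (h4 y (hball hy)).2 (by rw [hyv]; exact v.2)⟩, hyv⟩

end LocalCharts

/-! ### Polynomial functions, real algebraic sets and conormal spaces -/

section PolynomialFunctions

variable (E : Type*) [NormedAddCommGroup E] [NormedSpace ℝ E]

/-- The real algebra of polynomial functions on `E`: the one generated by the linear functionals. -/
def polyFun : Subalgebra ℝ (E → ℝ) :=
  Algebra.adjoin ℝ (range fun φ : E →L[ℝ] ℝ => (φ : E → ℝ))

variable {E}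

theorem ContinuousLinearMap.mem_polyFun (φ : E →L[ℝ] ℝ) : (φ : E → ℝ) ∈ polyFun E :=
  Algebra.subset_adjoin ⟨φ, rfl⟩

theorem contDiff_of_mem_polyFun {f : E → ℝ} (hf : f ∈ polyFun E) : ContDiff ℝ ∞ f := by
  induction hf using Algebra.adjoin_induction with
  | mem f hf => obtain ⟨φ, rfl⟩ := hf; exact φ.contDiff
  | algebraMap r => exact contDiff_const
  | add f g _ _ hf hg => exact hf.add hg
  | mul f g _ _ hf hg => exact hf.mul hg

theorem polyFun.contDiff (f : polyFun E) : ContDiff ℝ ∞ (f : E → ℝ) := contDiff_of_mem_polyFun f.2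

theorem polyFun.differentiable (f : polyFun E) : Differentiable ℝ (f : E → ℝ) :=
  (polyFun.contDiff f).differentiable (by simp)

theorem polyFun.continuous (f : polyFun E) : Continuous (f : E → ℝ) :=
  (polyFun.contDiff f).continuous

theorem fderiv_apply_mem_polyFun {f : E → ℝ} (hf : f ∈ polyFun E) (v : E) :
    (fun x => fderiv ℝ f x v) ∈ polyFun E := by
  induction hf using Algebra.adjoin_induction with
  | mem f hf =>
    obtain ⟨φ, rfl⟩ := hf
    simp only [ContinuousLinearMap.fderiv]
    exact (polyFun E).algebraMap_mem (φ v)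
  | algebraMap r =>
    have : (fun x => fderiv ℝ (algebraMap ℝ (E → ℝ) r) x v) = 0 := by
      funext x
      have : (algebraMap ℝ (E → ℝ) r) = fun _ => r := rfl
      rw [this]; simp
    rw [this]; exact zero_mem _
  | add f g hf hg hf' hg' =>
    refine (congrArg (· ∈ polyFun E) (funext fun x => ?_)).mpr (add_mem hf' hg')
    rw [fderiv_add ((contDiff_of_mem_polyFun hf).differentiable (by simp) x)
      ((contDiff_of_mem_polyFun hg).differentiable (by simp) x)]
    rfl
  | mul f g hf hg hf' hg' =>
    refine (congrArg (· ∈ polyFun E) (funext fun x => ?_)).mpr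
      (add_mem (mul_mem hf hg') (mul_mem hg hf'))
    rw [fderiv_mul ((contDiff_of_mem_polyFun hf).differentiable (by simp) x)
      ((contDiff_of_mem_polyFun hg).differentiable (by simp) x)]
    rfl

theorem comp_mem_polyFun {F : Type*} [NormedAddCommGroup F] [NormedSpace ℝ F] {f : F → ℝ}
    (hf : f ∈ polyFun F) (g : E →L[ℝ] F) : (fun x => f (g x)) ∈ polyFun E := by
  induction hf using Algebra.adjoin_induction with
  | mem f hf => obtain ⟨φ, rfl⟩ := hf; exact (φ.comp g).mem_polyFun
  | algebraMap r => exact (polyFun E).algebraMap_mem r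
  | add f g _ _ hf hg => exact add_mem hf hg
  | mul f g _ _ hf hg => exact mul_mem hf hg

/-- The derivative of a polynomial function in a constant direction. -/
noncomputable def polyFun.dir (f : polyFun E) (v : E) : polyFun E :=
  ⟨fun x => fderiv ℝ (f : E → ℝ) x v, fderiv_apply_mem_polyFun f.2 v⟩

/-- Evaluation of polynomial functions. -/
noncomputable def polyFun.ev (x : E) : polyFun E →+* ℝ :=
  (Pi.evalRingHom (fun _ : E => ℝ) x).comp (polyFun E).val.toRingHom

theorem polyFun.ev_apply (x : E) (f : polyFun E) : polyFun.ev x f = (f : E → ℝ) x := rfl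

theorem polyFun.ev_dir (x v : E) (f : polyFun E) :
    polyFun.ev x (polyFun.dir f v) = fderiv ℝ (f : E → ℝ) x v := rfl

/-- The coordinates of a basis generate the algebra, so Hilbert's basis theorem applies. It provides
finite generators of vanishing ideals and the termination of the stratification. -/
instance [FiniteDimensional ℝ E] : IsNoetherianRing (polyFun E) := by
  classical
  let b := Module.finBasis ℝ E
  let t : Finset (E → ℝ) := Finset.univ.image fun i => (b.coord i : E → ℝ)
  have : polyFun E = Algebra.adjoin ℝ (t : Set (E → ℝ)) := by
    apply le_antisymm
    · refine Algebra.adjoin_le ?_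
      rintro _ ⟨φ, rfl⟩
      have : (φ : E → ℝ) = ∑ i, φ (b i) • (b.coord i : E → ℝ) := by
        funext x
        conv_lhs => rw [← b.sum_repr x]
        simp only [map_sum, map_smul, Finset.sum_apply, Pi.smul_apply, smul_eq_mul,
          Module.Basis.coord_apply, mul_comm]
      change (φ : E → ℝ) ∈ _
      rw [this]
      refine sum_mem fun i _ => Subalgebra.smul_mem _ (Algebra.subset_adjoin ?_) _
      exact Finset.mem_image_of_mem _ (Finset.mem_univ i)
    · refine Algebra.adjoin_mono ?_
      intro f hf
      simp only [t, Finset.coe_image, Finset.coe_univ, image_univ, mem_range] at hf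
      obtain ⟨i, rfl⟩ := hf
      exact ⟨LinearMap.toContinuousLinearMap (b.coord i), rfl⟩
  rw [this]
  exact isNoetherianRing_of_fg ⟨t, rfl⟩

/-- The ideal of polynomial functions vanishing on `Z`. -/
def polyVanishing (Z : Set E) : Ideal (polyFun E) where
  carrier := {f | ∀ x ∈ Z, (f : E → ℝ) x = 0}
  add_mem' := by
    intro f g hf hg x hx
    simp [hf x hx, hg x hx]
  zero_mem' := by intro x _; rfl
  smul_mem' := by
    intro c f hf x hx
    simp [hf x hx]

/-- Real algebraic subsets. -/
def IsPolyClosed (Z : Set E) : Prop := ∀ x, (∀ f ∈ polyVanishing Z, (f : E → ℝ) x = 0) → x ∈ Z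

theorem isPolyClosed_setOf (I : Set (polyFun E)) :
    IsPolyClosed {x : E | ∀ f ∈ I, (f : E → ℝ) x = 0} :=
  fun _ hx f hf => hx f fun _ hy => hy f hf

theorem IsPolyClosed.inter {Z W : Set E} (hZ : IsPolyClosed Z) (hW : IsPolyClosed W) :
    IsPolyClosed (Z ∩ W) :=
  fun x hx => ⟨hZ x fun f hf => hx f fun y hy => hf y hy.1,
    hW x fun f hf => hx f fun y hy => hf y hy.2⟩

theorem polyVanishing_anti {Z W : Set E} (h : W ⊆ Z) : polyVanishing Z ≤ polyVanishing W :=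
  fun _ hf x hx => hf x (h hx)

theorem polyVanishing_lt {Z W : Set E} (hW : IsPolyClosed W) (h : W ⊂ Z) :
    polyVanishing Z < polyVanishing W := by
  refine lt_of_le_not_ge (polyVanishing_anti h.subset) fun hle => h.not_subset fun x hx => ?_
  exact hW x fun f hf => hle hf x hx

/-- The span of the differentials at `x` of the polynomial functions vanishing on `Z`. -/
def conormal (Z : Set E) (x : E) : Submodule ℝ (E →L[ℝ] ℝ) :=
  Submodule.span ℝ ((fun f : polyFun E => fderiv ℝ (f : E → ℝ) x) '' (polyVanishing Z : Set _))

/-- The codimension of the Zariski tangent space of `Z` at `x`. -/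
noncomputable def corank (Z : Set E) (x : E) : ℕ := Module.finrank ℝ (conormal Z x)

theorem conormal_mem {Z : Set E} (x : E) {f : polyFun E} (hf : f ∈ polyVanishing Z) :
    fderiv ℝ (f : E → ℝ) x ∈ conormal Z x := Submodule.subset_span ⟨f, hf, rfl⟩

/-- The Jacobian matrix of polynomial functions in given directions. -/
noncomputable def jacobian {ι : Type*} (f : ι → polyFun E) (v : ι → E) : Matrix ι ι (polyFun E) :=
  Matrix.of fun i j => polyFun.dir (f i) (v j)

variable [FiniteDimensional ℝ E]

/-- Independent differentials are jointly surjective, so directions dual to them exist; with these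
the Jacobian at `x` is the identity. -/
theorem exists_jacobian_ne_zero (Z : Set E) (x : E) {r : ℕ} (hr : r ≤ corank Z x) :
    ∃ (f : Fin r → polyFun E) (v : Fin r → E), (∀ i, f i ∈ polyVanishing Z) ∧
      (polyFun.ev x) (jacobian f v).det ≠ 0 := by
  obtain ⟨b, hb1, hb2, hb3⟩ := Submodule.exists_fun_fin_finrank_span_eq ℝ
    ((fun f : polyFun E => fderiv ℝ (f : E → ℝ) x) '' (polyVanishing Z : Set _))
  choose g hg hgb using hb1
  let f : Fin r → polyFun E := fun i => g (Fin.castLE hr i)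
  have hli : LinearIndependent ℝ fun i : Fin r => b (Fin.castLE hr i) :=
    hb3.comp _ (Fin.castLE_injective hr)
  have hli' : LinearIndependent ℝ fun i : Fin r => ((b (Fin.castLE hr i)) : E →ₗ[ℝ] ℝ) :=
    hli.map' (ContinuousLinearMap.coeLM ℝ) (by
      rw [LinearMap.ker_eq_bot]; exact ContinuousLinearMap.coe_injective)
  -- the joint evaluation map is onto
  let Φ : E →ₗ[ℝ] (Fin r → ℝ) := LinearMap.pi fun i => ((b (Fin.castLE hr i)) : E →ₗ[ℝ] ℝ)
  have hsurj : Function.Surjective Φ := by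
    rw [← LinearMap.range_eq_top]
    by_contra hne
    obtain ⟨ψ, hψ0, hψ⟩ := Submodule.exists_le_ker_of_lt_top _ (lt_top_iff_ne_top.2 hne)
    apply hψ0
    have hz : ∑ i, (ψ (Pi.single i 1)) • ((b (Fin.castLE hr i)) : E →ₗ[ℝ] ℝ) = 0 := by
      ext y
      have : ψ (Φ y) = 0 := hψ ⟨y, rfl⟩
      rw [LinearMap.pi_apply_eq_sum_univ ψ] at this
      have he : ∀ i : Fin r, (fun j => if i = j then (1 : ℝ) else 0) = Pi.single i 1 := by
        intro i; funext j; simp [Pi.single_apply, eq_comm]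
      simpa [Φ, mul_comm, he] using this
    have := Fintype.linearIndependent_iff.1 hli' _ hz
    ext i
    simpa using this i
  choose v hv using fun j : Fin r => hsurj (Pi.single j 1)
  refine ⟨f, v, fun i => hg _, ?_⟩
  have : (polyFun.ev x).mapMatrix (jacobian f v) = 1 := by
    ext i j
    have h1 := congrFun (hv j) i
    simp only [Φ, LinearMap.pi_apply] at h1
    simp only [RingHom.mapMatrix_apply, Matrix.map_apply, jacobian, Matrix.of_apply,
      polyFun.ev_dir]
    rw [Matrix.one_apply]
    have h2 : fderiv ℝ (f i : E → ℝ) x = b (Fin.castLE hr i) := hgb _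
    rw [h2]
    have : (b (Fin.castLE hr i)) (v j) = (Pi.single j (1 : ℝ) : Fin r → ℝ) i := h1
    rw [this, Pi.single_apply]
  rw [RingHom.map_det, this]; simp

theorem le_corank_of_jacobian_ne_zero {Z : Set E} {x : E} {r : ℕ} {f : Fin r → polyFun E}
    {v : Fin r → E} (hf : ∀ i, f i ∈ polyVanishing Z)
    (h : (polyFun.ev x) (jacobian f v).det ≠ 0) : r ≤ corank Z x ∧
      LinearIndependent ℝ fun i => fderiv ℝ (f i : E → ℝ) x := by
  have hli : LinearIndependent ℝ fun i => fderiv ℝ (f i : E → ℝ) x := by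
    rw [Fintype.linearIndependent_iff]
    intro c hc
    rw [RingHom.map_det] at h
    have : Matrix.vecMul c ((polyFun.ev x).mapMatrix (jacobian f v)) = 0 := by
      funext j
      have := congrArg (fun L : E →L[ℝ] ℝ => L (v j)) hc
      simpa [Matrix.vecMul, dotProduct, jacobian, polyFun.ev_dir,
        sum_apply] using this
    have h0 := Matrix.eq_zero_of_vecMul_eq_zero h this
    exact fun i => congrFun h0 i
  refine ⟨?_, hli⟩
  have hli2 : LinearIndependent ℝ fun i : Fin r =>
      (⟨fderiv ℝ (f i : E → ℝ) x, conormal_mem x (hf i)⟩ : conormal Z x) :=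
    LinearIndependent.of_comp (conormal Z x).subtype hli
  simpa [corank] using hli2.fintype_card_le_finrank

/-- The condition on the rank is the vanishing of all `r × r` Jacobian minors of functions in the
ideal, and these minors are themselves polynomial. -/
theorem isPolyClosed_corank_lt {Z : Set E} (hZ : IsPolyClosed Z) (r : ℕ) :
    IsPolyClosed {x ∈ Z | corank Z x < r} := by
  have : {x ∈ Z | corank Z x < r} = Z ∩ {x | ∀ g ∈ {g : polyFun E |
      ∃ (f : Fin r → polyFun E) (v : Fin r → E), (∀ i, f i ∈ polyVanishing Z) ∧
      g = (jacobian f v).det}, (g : E → ℝ) x = 0} := by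
    ext x
    simp only [mem_ofPred_eq, mem_inter_iff]
    refine and_congr_right fun _ => ⟨?_, fun h => ?_⟩
    · rintro h g ⟨f, v, hf, rfl⟩
      by_contra hne
      have := (le_corank_of_jacobian_ne_zero (x := x) hf hne).1
      omega
    · by_contra hlt
      obtain ⟨f, v, hf, hne⟩ := exists_jacobian_ne_zero Z x (not_lt.1 hlt)
      exact hne (h _ ⟨f, v, hf, rfl⟩)
  rw [this]
  exact hZ.inter (isPolyClosed_setOf _)

end PolynomialFunctions

/-! ### Tangential derivatives of the equations under maximal corank -/

section RegularPoints

variable {E : Type*} [NormedAddCommGroup E] [NormedSpace ℝ E]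

/-- Up to a factor, the derivative of `g` in the direction of the projection of `w` to the joint
kernel of the differentials of the `f i` along the span of the `v j`. -/
noncomputable def tangentialDeriv {r : ℕ} (f : Fin r → polyFun E) (v : Fin r → E) (g : polyFun E)
    (w : E) : polyFun E :=
  (jacobian f v).det * ((jacobian f v).det * polyFun.dir g w -
    Matrix.vecMul (fun j => polyFun.dir g (v j)) (jacobian f v).adjugate ⬝ᵥ
      fun i => polyFun.dir (f i) w)

theorem exists_ev_tangentialDeriv {r : ℕ} (f : Fin r → polyFun E) (v : Fin r → E) (g : polyFun E)
    (y : E) : ∃ q : Fin r → ℝ, ∀ w, polyFun.ev y (tangentialDeriv f v g w) =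
      polyFun.ev y (jacobian f v).det * (polyFun.ev y (jacobian f v).det *
        fderiv ℝ (g : E → ℝ) y w - ∑ i, q i * fderiv ℝ (f i : E → ℝ) y w) := by
  refine ⟨fun i => polyFun.ev y (Matrix.vecMul (fun j => polyFun.dir g (v j))
    (jacobian f v).adjugate i), fun w => ?_⟩
  simp only [tangentialDeriv, map_mul, map_sub, dotProduct, map_sum, polyFun.ev_dir]

/-- Where the minor is nonzero, maximality of `r` makes the differentials of the `f i` span the
conormal space, so that of `g` is a combination of them and the bracket vanishes by Cramer's rule.
Where the minor is zero, the leading factor of `tangentialDeriv` vanishes. -/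
theorem tangentialDeriv_mem [FiniteDimensional ℝ E] {Z : Set E} {r : ℕ}
    (hmax : ∀ z ∈ Z, corank Z z ≤ r) {f : Fin r → polyFun E} (v : Fin r → E)
    (hf : ∀ i, f i ∈ polyVanishing Z) {g : polyFun E} (hg : g ∈ polyVanishing Z) (w : E) :
    tangentialDeriv f v g w ∈ polyVanishing Z := by
  intro z hz
  rw [← polyFun.ev_apply]
  by_cases h : polyFun.ev z (jacobian f v).det = 0
  · simp [tangentialDeriv, h]
  obtain ⟨hle, hli⟩ := le_corank_of_jacobian_ne_zero hf h
  have hr : corank Z z = r := le_antisymm (hmax z hz) hle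
  have hspan : Submodule.span ℝ (range fun i => fderiv ℝ (f i : E → ℝ) z) = conormal Z z := by
    apply Submodule.eq_of_le_of_finrank_eq
    · rw [Submodule.span_le]
      rintro _ ⟨i, rfl⟩
      exact conormal_mem z (hf i)
    · rw [finrank_span_eq_card hli, Fintype.card_fin]; exact hr.symm
  have hgz := conormal_mem z hg
  rw [← hspan, Submodule.mem_span_range_iff_exists_fun] at hgz
  obtain ⟨c, hc⟩ := hgz
  have hc' : ∀ u, fderiv ℝ (g : E → ℝ) z u = ∑ i, c i * fderiv ℝ (f i : E → ℝ) z u := by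
    intro u
    rw [← hc]; simp [sum_apply]
  set M := (polyFun.ev z).mapMatrix (jacobian f v) with hM
  have h1 : (polyFun.ev z ∘ fun j => polyFun.dir g (v j)) = Matrix.vecMul c M := by
    funext j
    simp [polyFun.ev_dir, hc', Matrix.vecMul, dotProduct, hM, jacobian]
  have h2 : (polyFun.ev z) (Matrix.vecMul (fun j => polyFun.dir g (v j))
      (jacobian f v).adjugate ⬝ᵥ fun i => polyFun.dir (f i) w) =
      M.det * fderiv ℝ (g : E → ℝ) z w := by
    rw [RingHom.map_dotProduct]
    have : (polyFun.ev z ∘ Matrix.vecMul (fun j => polyFun.dir g (v j))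
        (jacobian f v).adjugate) = M.det • c := by
      have : (polyFun.ev z ∘ Matrix.vecMul (fun j => polyFun.dir g (v j))
          (jacobian f v).adjugate) = Matrix.vecMul (Matrix.vecMul c M) M.adjugate := by
        funext i
        rw [Function.comp_apply, RingHom.map_vecMul, h1, hM, ← RingHom.map_adjugate]
        rfl
      rw [this, Matrix.vecMul_vecMul, Matrix.mul_adjugate, Matrix.vecMul_smul, Matrix.vecMul_one]
    rw [this, smul_dotProduct, hc' w]
    rfl
  rw [tangentialDeriv, map_mul, map_sub, h2, map_mul, polyFun.ev_dir, RingHom.map_det, ← hM]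
  ring

/-- The tangential derivatives of the generators lie in the ideal again, hence are combinations of
the generators. Dividing by the square of the minor yields a linear differential inequality, ready
for Grönwall. -/
theorem exists_tangential_bound [FiniteDimensional ℝ E] {Z : Set E} {x : E} {r m : ℕ}
    (hmax : ∀ z ∈ Z, corank Z z ≤ r) {f : Fin r → polyFun E} {v : Fin r → E}
    (hf : ∀ i, f i ∈ polyVanishing Z) (hne : polyFun.ev x (jacobian f v).det ≠ 0)
    {g : Fin m → polyFun E} (hg : Ideal.span (range g) = polyVanishing Z) :
    ∃ C, ∀ᶠ y in 𝓝 x, ∀ w, (∀ i, fderiv ℝ (f i : E → ℝ) y w = 0) → ∀ k,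
      |fderiv ℝ (g k : E → ℝ) y w| ≤ C * ‖w‖ * ‖fun k => (g k : E → ℝ) y‖ := by
  let b := Module.finBasis ℝ E
  have hex : ∀ k l, ∃ a : Fin m → polyFun E,
      ∑ j, a j * g j = tangentialDeriv f v (g k) (b l) := by
    intro k l
    have hk : g k ∈ polyVanishing Z := hg ▸ Ideal.subset_span ⟨k, rfl⟩
    have := tangentialDeriv_mem hmax v hf hk (b l)
    rw [← hg] at this
    simpa using (Submodule.mem_span_range_iff_exists_fun (polyFun E)).1 this
  choose a ha using hex
  let co : ∀ l, E →L[ℝ] ℝ := fun l => LinearMap.toContinuousLinearMap (b.coord l)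
  let Δ : E → ℝ := ((jacobian f v).det : polyFun E)
  let B : E → ℝ := fun y => ∑ k, ∑ l, ∑ j, ‖co l‖ * |(a k l j : E → ℝ) y|
  have hΔ : Continuous Δ := polyFun.continuous _
  have hB : Continuous B := by
    refine continuous_finsetSum _ fun k _ => continuous_finsetSum _ fun l _ =>
      continuous_finsetSum _ fun j _ => continuous_const.mul (polyFun.continuous _).abs
  have hΔx : Δ x ≠ 0 := hne
  have hCc : ContinuousAt (fun y => B y / Δ y ^ 2) x :=
    hB.continuousAt.div (hΔ.pow 2).continuousAt (pow_ne_zero 2 hΔx)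
  -- The quotient `B / Δ²` is continuous at `x`, so it stays below its value plus one nearby.
  refine ⟨B x / Δ x ^ 2 + 1, ?_⟩
  filter_upwards [hΔ.continuousAt.eventually_ne hΔx,
    hCc.eventually_lt continuousAt_const (lt_add_one _)] with y hy1 hy2 w hw k
  obtain ⟨q, hq⟩ := exists_ev_tangentialDeriv f v (g k) y
  set G : Fin m → ℝ := fun k => (g k : E → ℝ) y with hG
  -- Expand `w` in the basis; the correction terms in `tangentialDeriv` disappear because `w` is
  -- killed by the differentials of the `f i`.
  have h1 : Δ y ^ 2 * fderiv ℝ (g k : E → ℝ) y w =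
      ∑ l, co l w * ∑ j, (a k l j : E → ℝ) y * G j := by
    have e1 : ∀ l, ∑ j, (a k l j : E → ℝ) y * G j = Δ y * (Δ y *
        fderiv ℝ (g k : E → ℝ) y (b l) - ∑ i, q i * fderiv ℝ (f i : E → ℝ) y (b l)) := by
      intro l
      have := congrArg (polyFun.ev y) (ha k l)
      rw [hq, map_sum] at this
      simp only [map_mul] at this
      exact this
    have hwsum : w = ∑ l, co l w • b l := by
      conv_lhs => rw [← b.sum_repr w]
      rfl
    let Λ : E →ₗ[ℝ] ℝ := (Δ y • (Δ y • fderiv ℝ (g k : E → ℝ) y -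
        ∑ i, q i • fderiv ℝ (f i : E → ℝ) y) : E →L[ℝ] ℝ)
    have hΛ : ∀ u, Λ u = Δ y * (Δ y * fderiv ℝ (g k : E → ℝ) y u -
        ∑ i, q i * fderiv ℝ (f i : E → ℝ) y u) := by
      intro u; simp [Λ]
    have e2 : Λ w = ∑ l, co l w * Λ (b l) := by
      conv_lhs => rw [hwsum, map_sum]
      simp
    simp only [e1, ← hΛ]
    rw [← e2, hΛ]
    simp [hw]
    ring
  have h2 : |∑ l, co l w * ∑ j, (a k l j : E → ℝ) y * G j| ≤ B y * (‖w‖ * ‖G‖) := by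
    have hk : ∑ l, ∑ j, ‖co l‖ * |(a k l j : E → ℝ) y| ≤ B y :=
      Finset.single_le_sum (f := fun k => ∑ l, ∑ j, ‖co l‖ * |(a k l j : E → ℝ) y|)
        (fun k _ => by positivity) (Finset.mem_univ k)
    calc _ ≤ ∑ l, |co l w * ∑ j, (a k l j : E → ℝ) y * G j| := Finset.abs_sum_le_sum_abs _ _
      _ ≤ ∑ l, (∑ j, ‖co l‖ * |(a k l j : E → ℝ) y|) * (‖w‖ * ‖G‖) := by
        refine Finset.sum_le_sum fun l _ => ?_
        rw [abs_mul, ← Finset.mul_sum]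
        have i1 : |co l w| ≤ ‖co l‖ * ‖w‖ := (co l).le_opNorm w
        have i2 : |∑ j, (a k l j : E → ℝ) y * G j| ≤ (∑ j, |(a k l j : E → ℝ) y|) * ‖G‖ := by
          refine (Finset.abs_sum_le_sum_abs _ _).trans ?_
          rw [Finset.sum_mul]
          refine Finset.sum_le_sum fun j _ => ?_
          rw [abs_mul]
          exact mul_le_mul_of_nonneg_left (norm_le_pi_norm G j) (abs_nonneg _)
        calc _ ≤ (‖co l‖ * ‖w‖) * ((∑ j, |(a k l j : E → ℝ) y|) * ‖G‖) :=
              mul_le_mul i1 i2 (abs_nonneg _) (by positivity)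
          _ = _ := by ring
      _ = (∑ l, ∑ j, ‖co l‖ * |(a k l j : E → ℝ) y|) * (‖w‖ * ‖G‖) := by rw [Finset.sum_mul]
      _ ≤ _ := mul_le_mul_of_nonneg_right hk (by positivity)
  have hpos : 0 < Δ y ^ 2 := by positivity
  rw [← h1, abs_mul, abs_of_pos hpos] at h2
  have h3 : |fderiv ℝ (g k : E → ℝ) y w| ≤ B y / Δ y ^ 2 * (‖w‖ * ‖G‖) := by
    rw [div_mul_eq_mul_div, le_div_iff₀ hpos]; linarith
  rw [mul_assoc]
  exact h3.trans (mul_le_mul_of_nonneg_right hy2.le (by positivity))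

end RegularPoints

/-! ### Smoothness of a real algebraic set at points of maximal corank -/

section RegularPoints

variable {E : Type*} [NormedAddCommGroup E] [NormedSpace ℝ E] [FiniteDimensional ℝ E]

/-- The joint zero set of functions with a nonzero Jacobian minor, in a chart. -/
theorem exists_straightening {r : ℕ} {f : Fin r → polyFun E} {v : Fin r → E} {x : E}
    (hx : ∀ i, (f i : E → ℝ) x = 0) (hne : polyFun.ev x (jacobian f v).det ≠ 0) :
    ∃ (φ : OpenPartialHomeomorph E E) (V : Submodule ℝ E), x ∈ φ.source ∧ φ x = 0 ∧
      ContDiffOn ℝ ∞ φ φ.source ∧ ContDiffOn ℝ ∞ φ.symm φ.target ∧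
      Module.finrank ℝ V = Module.finrank ℝ E - r ∧
      ∀ y, (∀ i, (f i : E → ℝ) y = 0) ↔ φ y ∈ V := by
  set M := (polyFun.ev x).mapMatrix (jacobian f v) with hM
  have hdet : IsUnit M.det := by
    rw [hM, ← RingHom.map_det]; exact isUnit_iff_ne_zero.2 hne
  let F : E → Fin r → ℝ := fun y i => (f i : E → ℝ) y
  let F' : E →L[ℝ] (Fin r → ℝ) := ContinuousLinearMap.pi fun i => fderiv ℝ (f i : E → ℝ) x
  -- A right inverse of `F'` with values in the span of the `v j`.
  let R : (Fin r → ℝ) →ₗ[ℝ] E := (Fintype.linearCombination ℝ v).comp M⁻¹.mulVecLin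
  let R' : (Fin r → ℝ) →L[ℝ] E := LinearMap.toContinuousLinearMap R
  have hR : ∀ t, F' (R' t) = t := by
    intro t
    have : F' (R' t) = M.mulVec (M⁻¹.mulVec t) := by
      funext i
      simp [F', R', R, Fintype.linearCombination_apply, Matrix.mulVec, dotProduct, hM, jacobian,
        polyFun.ev_dir, mul_comm]
    rw [this, Matrix.mulVec_mulVec, Matrix.mul_nonsing_inv _ hdet, Matrix.one_mulVec]
  have hF : ContDiff ℝ ∞ F := contDiff_pi.2 fun i => polyFun.contDiff (f i)
  have hFd : HasFDerivAt F F' x := hasFDerivAt_pi.2 fun i =>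
    (polyFun.differentiable (f i) x).hasFDerivAt
  -- This map has derivative the identity at `x` and satisfies `F' ∘ ψ = F` exactly, so the zero set
  -- of `F` is the preimage of the kernel of `F'`.
  let ψ : E → E := fun y => R' (F y) + ((y - x) - R' (F' (y - x)))
  have hψ : ContDiff ℝ ∞ ψ := by fun_prop
  have hψd : HasFDerivAt ψ ((ContinuousLinearEquiv.refl ℝ E : E ≃L[ℝ] E) : E →L[ℝ] E) x := by
    have h1 : HasFDerivAt (fun y : E => y - x) (ContinuousLinearMap.id ℝ E) x :=
      (hasFDerivAt_id x).sub_const x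
    have h2 := (R'.hasFDerivAt.comp x hFd).add
      (h1.sub ((R'.comp F').hasFDerivAt.comp x h1))
    refine h2.congr_fderiv ?_
    ext u; simp
  obtain ⟨φ, h1, -, h3, h4, h5⟩ :=
    exists_openPartialHomeomorph_of_contDiffOn isOpen_univ (mem_univ x) hψ.contDiffOn hψd
  refine ⟨φ, LinearMap.ker (F' : E →ₗ[ℝ] (Fin r → ℝ)), h1, ?_, h4, h5, ?_, fun y => ?_⟩
  · have : F x = 0 := funext hx
    rw [h3]; simp [ψ, this]
  · have hsurj : LinearMap.range (F' : E →ₗ[ℝ] (Fin r → ℝ)) = ⊤ :=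
      LinearMap.range_eq_top.2 fun t => ⟨R' t, hR t⟩
    have := LinearMap.finrank_range_add_finrank_ker (F' : E →ₗ[ℝ] (Fin r → ℝ))
    rw [hsurj, finrank_top, Module.finrank_fin_fun] at this
    omega
  · rw [h3, LinearMap.mem_ker]
    have : F' (ψ y) = F y := by
      simp only [ψ, map_add, map_sub, hR]; abel
    change _ ↔ F' (ψ y) = 0
    rw [this, funext_iff]; rfl

/-- Near a point where the Zariski tangent space has the smallest dimension, a real algebraic set
is a submanifold. -/
theorem isEmbeddedAt_of_corank_max {Z : Set E} (hZ : IsPolyClosed Z) {x : E} (hx : x ∈ Z)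
    (hmax : ∀ z ∈ Z, corank Z z ≤ corank Z x) :
    IsEmbeddedAt (Module.finrank ℝ E - corank Z x) {z ∈ Z | corank Z z = corank Z x} x := by
  obtain ⟨f, v, hf, hne⟩ := exists_jacobian_ne_zero Z x le_rfl
  obtain ⟨m, g, hg⟩ := Submodule.fg_iff_exists_fin_generating_family.1
    (IsNoetherian.noetherian (polyVanishing Z))
  have hgI : ∀ k, g k ∈ polyVanishing Z := fun k => hg ▸ Submodule.subset_span ⟨k, rfl⟩
  obtain ⟨C, hC⟩ := exists_tangential_bound hmax hf hne hg
  obtain ⟨φ, V, hxs, hφx, h1, h2, h3, h4⟩ := exists_straightening (fun i => hf i x hx) hne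
  -- the zero set of the `f i` is contained in `Z` near `x`
  have h0 : (0 : E) ∈ φ.target := hφx ▸ φ.map_source hxs
  have hsx : φ.symm 0 = x := by rw [← hφx, φ.left_inv hxs]
  have hev : ∀ᶠ u in 𝓝 (0 : E), u ∈ φ.target ∧ ∀ w,
      (∀ i, fderiv ℝ (f i : E → ℝ) (φ.symm u) w = 0) → ∀ k,
      |fderiv ℝ (g k : E → ℝ) (φ.symm u) w| ≤ C * ‖w‖ * ‖fun k => (g k : E → ℝ) (φ.symm u)‖ := by
    refine (φ.open_target.eventually_mem h0).and ?_
    have : Tendsto φ.symm (𝓝 0) (𝓝 x) := by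
      have := (φ.continuousAt_symm h0).tendsto
      rwa [hsx] at this
    exact this.eventually hC
  obtain ⟨ε, hε, hball⟩ := Metric.eventually_nhds_iff_ball.1 hev
  -- Along the segment from `0` to `k` in the chart all `f i` vanish, so velocities are tangential.
  -- The vector `G` of generators of the ideal starts at zero and satisfies `‖G'‖ ≤ const * ‖G‖`,
  -- hence stays zero.
  have key : ∀ k ∈ Metric.ball (0 : E) ε, k ∈ V → φ.symm k ∈ Z := by
    intro k hk hkV
    let γ : ℝ → E := fun t => φ.symm (t • k)
    let T : Set ℝ := {t | t • k ∈ Metric.ball (0 : E) ε}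
    have hT : IsOpen T := Metric.isOpen_ball.preimage (continuous_id.smul continuous_const)
    have hIT : Icc (0 : ℝ) 1 ⊆ T := by
      intro t ht
      simp only [T, mem_ofPred_eq, mem_ball_zero_iff, norm_smul, Real.norm_eq_abs] at hk ⊢
      rw [abs_of_nonneg ht.1]
      nlinarith [ht.2, norm_nonneg k]
    have hγ : ContDiffOn ℝ ∞ γ T :=
      h2.comp (contDiff_id.smul contDiff_const).contDiffOn fun t ht => (hball _ ht).1
    have hγd : ∀ t ∈ T, HasDerivAt γ (deriv γ t) t := fun t ht =>
      ((hγ.contDiffAt (hT.mem_nhds ht)).differentiableAt (by simp)).hasDerivAt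
    have hfd : ∀ (p : polyFun E), ∀ t ∈ T, HasDerivAt (fun s => (p : E → ℝ) (γ s))
        (fderiv ℝ (p : E → ℝ) (γ t) (deriv γ t)) t := fun p t ht =>
      (polyFun.differentiable p (γ t)).hasFDerivAt.comp_hasDerivAt t (hγd t ht)
    have hft : ∀ t ∈ T, ∀ i, fderiv ℝ (f i : E → ℝ) (γ t) (deriv γ t) = 0 := by
      intro t ht i
      refine (hfd (f i) t ht).unique ((hasDerivAt_const t (0 : ℝ)).congr_of_eventuallyEq ?_)
      filter_upwards [hT.mem_nhds ht] with s hs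
      refine (h4 (γ s)).2 ?_ i
      rw [φ.right_inv (hball _ hs).1]
      exact V.smul_mem s hkV
    obtain ⟨K, hK⟩ := isCompact_Icc.exists_bound_of_continuousOn
      ((hγ.continuousOn_deriv_of_isOpen hT (by simp)).mono hIT)
    let G : ℝ → Fin m → ℝ := fun t k => (g k : E → ℝ) (γ t)
    let G' : ℝ → Fin m → ℝ := fun t k => fderiv ℝ (g k : E → ℝ) (γ t) (deriv γ t)
    have hG : ∀ t ∈ T, HasDerivAt G (G' t) t := fun t ht =>
      hasDerivAt_pi.2 fun k => hfd (g k) t ht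
    have hzero := eq_zero_of_abs_deriv_le_mul_abs_self_of_eq_zero_right (f := G) (f' := G')
      (K := |C| * K) (a := 0) (b := 1)
      (fun t ht => (hG t (hIT ht)).continuousAt.continuousWithinAt)
      (fun t ht => (hG t (hIT (Ico_subset_Icc_self ht))).hasDerivWithinAt)
      (by
        funext k
        simp only [G, γ, zero_smul, hsx]
        exact hgI k x hx)
      (fun t ht => by
        have htI := Ico_subset_Icc_self ht
        have hK0 : 0 ≤ K := (norm_nonneg _).trans (hK t htI)
        refine (pi_norm_le_iff_of_nonneg (by positivity)).2 fun k => ?_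
        refine ((hball _ (hIT htI)).2 _ (hft t (hIT htI)) k).trans ?_
        refine mul_le_mul_of_nonneg_right ?_ (norm_nonneg _)
        exact mul_le_mul (le_abs_self C) (hK t htI) (norm_nonneg _) (abs_nonneg _)) 1 (by simp)
    have hγ1 : γ 1 = φ.symm k := by simp [γ]
    rw [← hγ1]
    refine hZ _ fun p hp => ?_
    rw [← hg, Submodule.mem_span_range_iff_exists_fun] at hp
    obtain ⟨c, rfl⟩ := hp
    rw [← polyFun.ev_apply, map_sum]
    refine Finset.sum_eq_zero fun k _ => ?_
    rw [smul_eq_mul, map_mul, polyFun.ev_apply _ (g k), show (g k : E → ℝ) (γ 1) = 0 from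
      congrFun hzero k, mul_zero]
  have hev1 : ∀ᶠ y in 𝓝 x, φ y ∈ Metric.ball (0 : E) ε := by
    refine (φ.continuousAt hxs).eventually_mem ?_
    rw [hφx]; exact Metric.ball_mem_nhds 0 hε
  have hev2 : ∀ᶠ y in 𝓝 x, polyFun.ev y (jacobian f v).det ≠ 0 :=
    (polyFun.continuous (jacobian f v).det).continuousAt.eventually_ne hne
  have hφ : IsEmbeddedAt (Module.finrank ℝ E - corank Z x)
      {y | ∀ i, (f i : E → ℝ) y = 0} x :=
    ⟨φ, V, hxs, h1, h2, h3, fun y _ => h4 y⟩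
  refine hφ.congr ?_
  filter_upwards [hev1, hev2, φ.open_source.mem_nhds hxs] with y hy1 hy2 hy3
  constructor
  · intro hy
    have hyZ : y ∈ Z := by
      rw [← φ.left_inv hy3]
      exact key _ hy1 ((h4 y).1 hy)
    exact ⟨hyZ, le_antisymm (hmax y hyZ) (le_corank_of_jacobian_ne_zero hf hy2).1⟩
  · exact fun hy i => hf i y hy.1

end RegularPoints

/-! ### Invariant stratification by Noetherian induction -/

section Stratification

variable {E : Type*} [NormedAddCommGroup E] [NormedSpace ℝ E]

/-- `Z` is mapped into itself by a family of linear automorphisms. -/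
def IsStable (𝒢 : Set (E ≃L[ℝ] E)) (Z : Set E) : Prop := ∀ g ∈ 𝒢, ∀ x ∈ Z, g x ∈ Z

/-- Pulling functions back along `g` preserves the ideal, and on differentials it embeds the
conormal space at `g x` into the one at `x`. -/
theorem corank_le_of_stable [FiniteDimensional ℝ E] {Z : Set E} {g : E ≃L[ℝ] E}
    (hg : ∀ x ∈ Z, g x ∈ Z) (x : E) : corank Z (g x) ≤ corank Z x := by
  let Φ : (E →L[ℝ] ℝ) →ₗ[ℝ] (E →L[ℝ] ℝ) :=
    { toFun := fun L => L.comp (g : E →L[ℝ] E)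
      map_add' := fun _ _ => rfl
      map_smul' := fun _ _ => rfl }
  have hΦ : Function.Injective Φ := by
    intro L L' h
    ext y
    have := congrArg (fun K : E →L[ℝ] ℝ => K (g.symm y)) h
    change L (g (g.symm y)) = L' (g (g.symm y)) at this
    rwa [g.apply_symm_apply] at this
  have : (conormal Z (g x)).map Φ ≤ conormal Z x := by
    rw [conormal, Submodule.map_span, Submodule.span_le]
    rintro _ ⟨_, ⟨f, hf, rfl⟩, rfl⟩
    let f' : polyFun E := ⟨fun y => (f : E → ℝ) (g y), comp_mem_polyFun f.2 (g : E →L[ℝ] E)⟩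
    have hf' : f' ∈ polyVanishing Z := fun y hy => hf (g y) (hg y hy)
    have : Φ (fderiv ℝ (f : E → ℝ) (g x)) = fderiv ℝ (f' : E → ℝ) x :=
      (((polyFun.differentiable f (g x)).hasFDerivAt.comp x g.hasFDerivAt).fderiv).symm
    change Φ (fderiv ℝ (f : E → ℝ) (g x)) ∈ _
    rw [this]
    exact conormal_mem x hf'
  unfold corank
  rw [(Submodule.equivMapOfInjective Φ hΦ (conormal Z (g x))).finrank_eq]
  exact Submodule.finrank_mono this

variable (𝒢 : Set (E ≃L[ℝ] E)) in
/-- A partition of `Z` into finitely many stable embedded submanifolds. -/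
def HasStratification [FiniteDimensional ℝ E] (Z : Set E) : Prop :=
  ∃ (ι : Type) (_ : Finite ι) (S : ι → Set E) (d : ι → ℕ),
    (∀ i, IsEmbeddedSubmanifold (d i) (S i)) ∧ (∀ i, IsStable 𝒢 (S i)) ∧
    (∀ i j, i ≠ j → Disjoint (S i) (S j)) ∧ ⋃ i, S i = Z

variable [FiniteDimensional ℝ E] {𝒢 : Set (E ≃L[ℝ] E)}

theorem hasStratification_iUnion {κ : Type} [Finite κ] {Z : κ → Set E}
    (h : ∀ k, HasStratification 𝒢 (Z k)) (hd : ∀ i j, i ≠ j → Disjoint (Z i) (Z j)) :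
    HasStratification 𝒢 (⋃ k, Z k) := by
  choose ι hι S d h1 h2 h3 h4 using h
  refine ⟨Σ k, ι k, inferInstance, fun p => S p.1 p.2, fun p => d p.1 p.2, fun p => h1 _ _,
    fun p => h2 _ _, ?_, ?_⟩
  · rintro ⟨k, i⟩ ⟨l, j⟩ hne
    by_cases hkl : k = l
    · subst hkl
      exact h3 k i j fun h => hne (by rw [h])
    · refine (hd k l hkl).mono ?_ ?_
      · rw [← h4 k]; exact subset_iUnion (S k) i
      · rw [← h4 l]; exact subset_iUnion (S l) j
  · rw [iUnion_sigma]
    exact iUnion_congr h4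

theorem HasStratification.inter_of_isOpen {Z U : Set E} (h : HasStratification 𝒢 Z)
    (hU : IsOpen U) (hUs : IsStable 𝒢 U) : HasStratification 𝒢 (Z ∩ U) := by
  obtain ⟨ι, hι, S, d, h1, h2, h3, h4⟩ := h
  refine ⟨ι, hι, fun i => S i ∩ U, d, fun i x hx => ?_,
    fun i g hg x hx => ⟨h2 i g hg x hx.1, hUs g hg x hx.2⟩,
    fun i j hij => (h3 i j hij).mono inter_subset_left inter_subset_left, ?_⟩
  · refine IsEmbeddedAt.congr (h1 i x hx.1) ?_
    filter_upwards [hU.mem_nhds hx.2] with y hy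
    exact ⟨fun h => ⟨h, hy⟩, fun h => h.1⟩
  · rw [← iUnion_inter, h4]

/-- A stable real algebraic set is a finite disjoint union of stable embedded submanifolds. -/
theorem IsPolyClosed.hasStratification (hsymm : ∀ g ∈ 𝒢, g.symm ∈ 𝒢) {Z : Set E}
    (hZ : IsPolyClosed Z) (hs : IsStable 𝒢 Z) : HasStratification 𝒢 Z := by
  induction hI : polyVanishing Z using
    (wellFounded_gt (α := Ideal (polyFun E))).induction generalizing Z with
  | h I ih =>
  subst hI
  rcases Z.eq_empty_or_nonempty with rfl | hne
  · exact ⟨Empty, inferInstance, fun i => i.elim, fun i => i.elim, fun i => i.elim,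
      fun i => i.elim, fun i => i.elim, by simp⟩
  have hcor : ∀ g ∈ 𝒢, ∀ x, corank Z (g x) = corank Z x := fun g hg x =>
    le_antisymm (corank_le_of_stable (hs g hg) x)
      (by simpa using corank_le_of_stable (hs _ (hsymm g hg)) (g x))
  have hbdd : ∀ x, corank Z x ≤ Module.finrank ℝ (E →L[ℝ] ℝ) := fun x =>
    Submodule.finrank_le _
  have hb : BddAbove (corank Z '' Z) := ⟨_, by rintro _ ⟨x, -, rfl⟩; exact hbdd x⟩
  obtain ⟨x, hx, hxs⟩ := Nat.sSup_mem (hne.image (corank Z)) hb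
  have hmax : ∀ z ∈ Z, corank Z z ≤ corank Z x := fun z hz =>
    hxs ▸ le_csSup hb ⟨z, hz, rfl⟩
  set r := corank Z x with hr
  have htop : HasStratification 𝒢 {z ∈ Z | corank Z z = r} := by
    refine ⟨Unit, inferInstance, fun _ => {z ∈ Z | corank Z z = r},
      fun _ => Module.finrank ℝ E - r, fun _ z hz => ?_,
      fun _ g hg z hz => ⟨hs g hg z hz.1, ?_⟩, fun i j hij => absurd rfl hij, iUnion_const _⟩
    · have h := isEmbeddedAt_of_corank_max hZ hz.1 (by rw [hz.2]; exact hmax)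
      rw [hz.2] at h
      exact h
    · rw [hcor g hg]; exact hz.2
  -- The point `x` of maximal corank is missing here, so the vanishing ideal is strictly larger and
  -- the induction applies.
  have hlow : HasStratification 𝒢 {z ∈ Z | corank Z z < r} := by
    have hcl := isPolyClosed_corank_lt hZ r
    refine ih _ (polyVanishing_lt hcl ⟨fun z hz => hz.1, fun h => ?_⟩) hcl
      (fun g hg z hz => ⟨hs g hg z hz.1, ?_⟩) rfl
    · exact lt_irrefl _ (h hx).2
    · rw [hcor g hg]; exact hz.2
  have := hasStratification_iUnion (𝒢 := 𝒢) (κ := Bool)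
    (Z := fun b => bif b then {z ∈ Z | corank Z z = r} else {z ∈ Z | corank Z z < r})
    (by rintro (_ | _) <;> assumption)
    (by
      have hdis : Disjoint {z ∈ Z | corank Z z = r} {z ∈ Z | corank Z z < r} :=
        disjoint_left.2 fun z hz hz' => hz'.2.ne hz.2
      rintro (_ | _) (_ | _) h
      · exact absurd rfl h
      · exact hdis.symm
      · exact hdis
      · exact absurd rfl h)
  convert this using 1
  ext z
  simp only [mem_iUnion, Bool.exists_bool, cond_false, cond_true, mem_ofPred_eq]
  constructor
  · intro hz
    rcases (hmax z hz).lt_or_eq with h | h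
    · exact Or.inl ⟨hz, h⟩
    · exact Or.inr ⟨hz, h⟩
  · rintro (h | h) <;> exact h.1

/-- A stable basic closed semialgebraic set, cut out by invariant inequalities, is a finite
disjoint union of stable embedded submanifolds. -/
theorem IsPolyClosed.hasStratification_nonneg (hsymm : ∀ g ∈ 𝒢, g.symm ∈ 𝒢) {Z : Set E}
    (hZ : IsPolyClosed Z) (hs : IsStable 𝒢 Z) {κ : Type} [Finite κ] (c : κ → polyFun E)
    (hc : ∀ g ∈ 𝒢, ∀ k x, (c k : E → ℝ) (g x) = (c k : E → ℝ) x) :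
    HasStratification 𝒢 {x ∈ Z | ∀ k, 0 ≤ (c k : E → ℝ) x} := by
  -- The pieces are indexed by the set `T` of inequalities that are strict; the others become
  -- equations, and strictness is an open condition.
  have key : ∀ T : Set κ, HasStratification 𝒢
      ((Z ∩ {x | ∀ f ∈ c '' Tᶜ, (f : E → ℝ) x = 0}) ∩ {x | ∀ k ∈ T, 0 < (c k : E → ℝ) x}) := by
    intro T
    refine ((hZ.inter (isPolyClosed_setOf _)).hasStratification hsymm ?_).inter_of_isOpen ?_ ?_
    · refine fun g hg x hx => ⟨hs g hg x hx.1, ?_⟩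
      rintro _ ⟨k, hk, rfl⟩
      rw [hc g hg]
      exact hx.2 _ ⟨k, hk, rfl⟩
    · have : {x : E | ∀ k ∈ T, 0 < (c k : E → ℝ) x} =
          ⋂ k ∈ T, {x | 0 < (c k : E → ℝ) x} := by ext; simp
      rw [this]
      exact (toFinite T).isOpen_biInter fun k _ =>
        isOpen_lt continuous_const (polyFun.continuous _)
    · intro g hg x hx k hk
      rw [hc g hg]; exact hx k hk
  have := hasStratification_iUnion key (by
    intro T T' hne
    refine disjoint_left.2 fun x hx hx' => hne (Set.ext fun k => ⟨fun hk => ?_, fun hk => ?_⟩)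
    · by_contra hk'
      exact (hx.2 k hk).ne' (hx'.1.2 _ ⟨k, hk', rfl⟩)
    · by_contra hk'
      exact (hx'.2 k hk).ne' (hx.1.2 _ ⟨k, hk', rfl⟩))
  convert this using 1
  ext x
  simp only [mem_iUnion]
  constructor
  · rintro ⟨hxZ, hx⟩
    refine ⟨{k | 0 < (c k : E → ℝ) x}, ⟨hxZ, ?_⟩, fun k hk => hk⟩
    rintro _ ⟨k, hk, rfl⟩
    exact le_antisymm (not_lt.1 hk) (hx k)
  · rintro ⟨T, ⟨hxZ, hx0⟩, hx⟩
    refine ⟨hxZ, fun k => ?_⟩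
    by_cases hk : k ∈ T
    · exact (hx k hk).le
    · exact (hx0 _ ⟨k, hk, rfl⟩).ge

end Stratification

/-! ### Inverses inside finite-dimensional subalgebras -/

section Subalgebra

/-- An element of a finite-dimensional subalgebra that is invertible in the ambient algebra is
invertible in the subalgebra. -/
theorem Subalgebra.isUnit_of_isUnit_coe {K A : Type*} [Field K] [Ring A] [Algebra K A]
    (S : Subalgebra K A) [FiniteDimensional K S] {a : S} (ha : IsUnit (a : A)) : IsUnit a := by
  have hinj : Function.Injective (LinearMap.mulLeft K a) := by
    intro x y h
    have : (a : A) * x = a * y := congrArg Subtype.val h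
    exact Subtype.ext (ha.mul_left_cancel this)
  obtain ⟨b, hb⟩ := (LinearMap.injective_iff_surjective.1 hinj) 1
  have hab : a * b = 1 := hb
  have hba : b * a = 1 := by
    apply hinj
    change a * (b * a) = a * 1
    rw [← mul_assoc, hab, one_mul, mul_one]
  exact ⟨⟨a, b, hab, hba⟩, rfl⟩

end Subalgebra

/-! ### Triangularization over the quaternions -/

section Triangularization

variable {n : ℕ}

theorem mem_quatMat_iff {Z : Matrix (Fin n ⊕ Fin n) (Fin n ⊕ Fin n) ℂ} :
    Z ∈ QuatMat n ↔ ∀ i j, Z (.inl i) (.inr j) = -conj (Z (.inr i) (.inl j)) ∧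
      Z (.inr i) (.inr j) = conj (Z (.inl i) (.inl j)) := by
  constructor
  · rintro ⟨X, Y, rfl⟩ i j
    simp
  · intro h
    refine ⟨Z.toBlocks₁₁, Z.toBlocks₁₂, ?_⟩
    ext (i | i) (j | j)
    · rfl
    · rfl
    · simp [Matrix.toBlocks₁₂, (h i j).1]
    · simp [Matrix.toBlocks₁₁, (h i j).2]

/-- Right multiplication by the quaternion `j` on `ℂ²ⁿ ≅ ℍⁿ`. -/
def quatJ (v : Fin n ⊕ Fin n → ℂ) : Fin n ⊕ Fin n → ℂ :=
  Sum.elim (fun i => -conj (v (.inr i))) fun i => conj (v (.inl i))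

theorem quatJ_add (v w : Fin n ⊕ Fin n → ℂ) : quatJ (v + w) = quatJ v + quatJ w := by
  funext p; rcases p with i | i <;> simp [quatJ, add_comm]

theorem quatJ_smul (c : ℂ) (v : Fin n ⊕ Fin n → ℂ) : quatJ (c • v) = conj c • quatJ v := by
  funext p; rcases p with i | i <;> simp [quatJ]

theorem quatJ_zero : quatJ (0 : Fin n ⊕ Fin n → ℂ) = 0 := by
  funext p; rcases p with i | i <;> simp [quatJ]

theorem quatJ_quatJ (v : Fin n ⊕ Fin n → ℂ) : quatJ (quatJ v) = -v := by
  funext p; rcases p with i | i <;> simp [quatJ]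

/-- Left multiplication by a quaternionic matrix commutes with right scalars; this makes
quaternionic spans of eigenvectors stable. -/
theorem quatJ_mulVec {Z : Matrix (Fin n ⊕ Fin n) (Fin n ⊕ Fin n) ℂ} (hZ : Z ∈ QuatMat n)
    (v : Fin n ⊕ Fin n → ℂ) : Z.mulVec (quatJ v) = quatJ (Z.mulVec v) := by
  have h := mem_quatMat_iff.1 hZ
  funext p
  rcases p with i | i
  · simp only [Matrix.mulVec, dotProduct, Fintype.sum_sum_type, quatJ, Sum.elim_inl, Sum.elim_inr,
      map_add, map_sum, map_mul, (h _ _).1, (h _ _).2, Complex.conj_conj, mul_neg, neg_mul,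
      Finset.sum_neg_distrib, neg_add]
    ring
  · simp only [Matrix.mulVec, dotProduct, Fintype.sum_sum_type, quatJ, Sum.elim_inl, Sum.elim_inr,
      map_add, map_sum, map_mul, (h _ _).1, (h _ _).2, map_neg, Complex.conj_conj, mul_neg, neg_mul,
      Finset.sum_neg_distrib]
    ring

/-- The quaternionic span of `v 0, …, v (k - 1)`. -/
def quatSpan (v : ℕ → Fin n ⊕ Fin n → ℂ) (k : ℕ) : Submodule ℂ (Fin n ⊕ Fin n → ℂ) :=
  Submodule.span ℂ (range (Sum.elim (fun i : Fin k => v i) fun i : Fin k => quatJ (v i)))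

theorem quatSpan_le {v : ℕ → Fin n ⊕ Fin n → ℂ} {k : ℕ} {W : Submodule ℂ (Fin n ⊕ Fin n → ℂ)} :
    quatSpan v k ≤ W ↔ ∀ i < k, v i ∈ W ∧ quatJ (v i) ∈ W := by
  rw [quatSpan, Submodule.span_le, range_subset_iff]
  constructor
  · exact fun h i hi => ⟨h (.inl ⟨i, hi⟩), h (.inr ⟨i, hi⟩)⟩
  · rintro h (i | i)
    · exact (h i i.2).1
    · exact (h i i.2).2

theorem mem_quatSpan (v : ℕ → Fin n ⊕ Fin n → ℂ) {i k : ℕ} (h : i < k) :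
    v i ∈ quatSpan v k ∧ quatJ (v i) ∈ quatSpan v k := quatSpan_le.1 le_rfl i h

theorem quatSpan_mono (v : ℕ → Fin n ⊕ Fin n → ℂ) {j k : ℕ} (h : j ≤ k) :
    quatSpan v j ≤ quatSpan v k :=
  quatSpan_le.2 fun _ hi => mem_quatSpan v (hi.trans_le h)

theorem quatSpan_congr {v w : ℕ → Fin n ⊕ Fin n → ℂ} {k : ℕ} (h : ∀ i < k, v i = w i) :
    quatSpan v k = quatSpan w k := by
  apply le_antisymm <;> rw [quatSpan_le] <;> intro i hi
  · rw [h i hi]; exact mem_quatSpan w hi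
  · rw [← h i hi]; exact mem_quatSpan v hi

theorem quatJ_mem_quatSpan {v : ℕ → Fin n ⊕ Fin n → ℂ} {k : ℕ} {w : Fin n ⊕ Fin n → ℂ}
    (hw : w ∈ quatSpan v k) : quatJ w ∈ quatSpan v k := by
  induction hw using Submodule.span_induction with
  | mem x hx =>
    obtain ⟨i | i, rfl⟩ := hx
    · exact (mem_quatSpan v i.2).2
    · simp only [Sum.elim_inr, quatJ_quatJ]
      exact neg_mem (mem_quatSpan v i.2).1
  | zero => rw [quatJ_zero]; exact zero_mem _
  | add x y _ _ hx hy => rw [quatJ_add]; exact add_mem hx hy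
  | smul c x _ hx => rw [quatJ_smul]; exact Submodule.smul_mem _ _ hx

/-- A nonzero quaternion is invertible: eliminating `quatJ u` between the combination and its image
under `quatJ` leaves `(|a|² + |b|²) • u`. -/
theorem eq_zero_of_quatCombination_mem {v : ℕ → Fin n ⊕ Fin n → ℂ} {k : ℕ}
    {u : Fin n ⊕ Fin n → ℂ} (hu : u ∉ quatSpan v k) {a b : ℂ}
    (h : a • u + b • quatJ u ∈ quatSpan v k) : a = 0 ∧ b = 0 := by
  have h' := quatJ_mem_quatSpan h
  rw [quatJ_add, quatJ_smul, quatJ_smul, quatJ_quatJ] at h'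
  have h2 := sub_mem (Submodule.smul_mem _ (conj a) h) (Submodule.smul_mem _ b h')
  have h3 : conj a • (a • u + b • quatJ u) - b • (conj a • quatJ u + conj b • -u) =
      ((Complex.normSq a + Complex.normSq b : ℝ) : ℂ) • u := by
    push_cast
    rw [Complex.normSq_eq_conj_mul_self, Complex.normSq_eq_conj_mul_self]
    module
  rw [h3] at h2
  have h4 : Complex.normSq a + Complex.normSq b = 0 := by
    by_contra hne
    exact hu ((Submodule.smul_mem_iff _ (Complex.ofReal_ne_zero.2 hne)).1 h2)
  have ha := Complex.normSq_nonneg a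
  have hb := Complex.normSq_nonneg b
  exact ⟨Complex.normSq_eq_zero.1 (by linarith), Complex.normSq_eq_zero.1 (by linarith)⟩

/-- A quaternionic flag adapted to `A`. -/
def IsAdaptedFlag (A : Matrix (Fin n ⊕ Fin n) (Fin n ⊕ Fin n) ℂ) (v : ℕ → Fin n ⊕ Fin n → ℂ)
    (k : ℕ) : Prop :=
  ∀ j < k, v j ∉ quatSpan v j ∧ ∃ c : ℂ, A.mulVec (v j) - c • v j ∈ quatSpan v j

theorem IsAdaptedFlag.mulVec_mem {A : Matrix (Fin n ⊕ Fin n) (Fin n ⊕ Fin n) ℂ}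
    (hA : A ∈ QuatMat n) {v : ℕ → Fin n ⊕ Fin n → ℂ} {k : ℕ} (h : IsAdaptedFlag A v k) :
    quatSpan v k ≤ (quatSpan v k).comap A.mulVecLin := by
  rw [quatSpan_le]
  intro i hi
  have h1 : A.mulVec (v i) ∈ quatSpan v k := by
    obtain ⟨c, hc⟩ := (h i hi).2
    have := add_mem (quatSpan_mono v hi.le hc)
      (Submodule.smul_mem _ c (mem_quatSpan v hi).1)
    simpa using this
  refine ⟨h1, ?_⟩
  rw [Submodule.mem_comap, Matrix.mulVecLin_apply]
  rw [quatJ_mulVec hA]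
  exact quatJ_mem_quatSpan h1

/-- The span built so far is stable under `A` and has complex dimension at most `2k < 2n`. An
eigenvector of `A` on the nonzero quotient lifts to the next vector. -/
theorem exists_isAdaptedFlag {A : Matrix (Fin n ⊕ Fin n) (Fin n ⊕ Fin n) ℂ} (hA : A ∈ QuatMat n)
    {k : ℕ} (hk : k ≤ n) : ∃ v, IsAdaptedFlag A v k := by
  induction k with
  | zero => exact ⟨fun _ => 0, fun j hj => absurd hj (Nat.not_lt_zero j)⟩
  | succ k ih =>
    obtain ⟨v, hv⟩ := ih (Nat.le_of_succ_le hk)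
    set W := quatSpan v k with hW
    have hfin : Module.finrank ℂ W < Module.finrank ℂ (Fin n ⊕ Fin n → ℂ) := by
      have : Module.finrank ℂ W ≤ Fintype.card (Fin k ⊕ Fin k) := finrank_range_le_card _
      simp at this ⊢
      omega
    have hne : W ≠ ⊤ := by
      intro h
      rw [h, finrank_top] at hfin
      exact lt_irrefl _ hfin
    have : Nontrivial ((Fin n ⊕ Fin n → ℂ) ⧸ W) := Submodule.Quotient.nontrivial_iff.2 hne
    obtain ⟨c, hc⟩ := Module.End.exists_eigenvalue (W.mapQ W A.mulVecLin (hv.mulVec_mem hA))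
    obtain ⟨q, hq⟩ := hc.exists_hasEigenvector
    obtain ⟨u, rfl⟩ := W.mkQ_surjective q
    have hu1 : u ∉ W := fun h => hq.2 ((Submodule.Quotient.mk_eq_zero W).2 h)
    have hu2 : A.mulVec u - c • u ∈ W := by
      rw [← Submodule.Quotient.mk_eq_zero W]
      have := hq.apply_eq_smul
      rw [Submodule.mkQ_apply, Submodule.mapQ_apply] at this
      rw [Submodule.Quotient.mk_sub, Submodule.Quotient.mk_smul, ← this]
      simp
    refine ⟨Function.update v k u, fun j hj => ?_⟩
    have hcongr : quatSpan (Function.update v k u) j = quatSpan v j := by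
      refine quatSpan_congr fun i hi => Function.update_of_ne (by omega) _ _
    rw [hcongr]
    rcases (Nat.lt_succ_iff_lt_or_eq.1 hj) with h | rfl
    · rw [Function.update_of_ne h.ne]
      exact hv j h
    · rw [Function.update_self]
      exact ⟨hu1, c, hu2⟩

/-- The matrix with quaternionic columns `v 0, …, v (n - 1)`. -/
def quatColumns (v : ℕ → Fin n ⊕ Fin n → ℂ) : Matrix (Fin n ⊕ Fin n) (Fin n ⊕ Fin n) ℂ :=
  Matrix.of fun p => Sum.elim (fun j : Fin n => v j p) fun j : Fin n => quatJ (v j) p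

theorem quatColumns_mem (v : ℕ → Fin n ⊕ Fin n → ℂ) : quatColumns v ∈ QuatMat n :=
  mem_quatMat_iff.2 fun i j => by simp [quatColumns, quatJ]

/-- In a nontrivial relation among the columns, the largest index `j` involved would put a nonzero
quaternionic multiple of `v j` into `quatSpan v j`. -/
theorem isUnit_quatColumns {A : Matrix (Fin n ⊕ Fin n) (Fin n ⊕ Fin n) ℂ}
    {v : ℕ → Fin n ⊕ Fin n → ℂ} (h : IsAdaptedFlag A v n) : IsUnit (quatColumns v) := by
  rw [← Matrix.mulVec_injective_iff_isUnit]
  rw [← Matrix.coe_mulVecLin, ← LinearMap.ker_eq_bot, LinearMap.ker_eq_bot']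
  intro x hx
  by_contra hne
  have hex : (Finset.univ.filter fun j : Fin n => x (.inl j) ≠ 0 ∨ x (.inr j) ≠ 0).Nonempty := by
    by_contra hemp
    rw [Finset.not_nonempty_iff_eq_empty, Finset.filter_eq_empty_iff] at hemp
    refine hne (funext fun p => ?_)
    rcases p with j | j <;> have := hemp (Finset.mem_univ j) <;> push Not at this
    · exact this.1
    · exact this.2
  obtain ⟨j, hj, hmax⟩ := Finset.exists_max_image _ (fun j : Fin n => j) hex
  have hsum : ∑ i : Fin n, (x (.inl i) • v i + x (.inr i) • quatJ (v i)) = 0 := by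
    rw [← hx]
    funext p
    simp [Matrix.mulVec, dotProduct, quatColumns, Finset.sum_add_distrib, mul_comm]
  rw [← Finset.add_sum_erase _ _ (Finset.mem_univ j)] at hsum
  have hmem : x (.inl j) • v j + x (.inr j) • quatJ (v j) ∈ quatSpan v j := by
    rw [eq_neg_of_add_eq_zero_left hsum]
    refine neg_mem (sum_mem fun i hi => ?_)
    rcases lt_or_gt_of_ne (Finset.ne_of_mem_erase hi) with hij | hij
    · exact add_mem (Submodule.smul_mem _ _ (mem_quatSpan v hij).1)
        (Submodule.smul_mem _ _ (mem_quatSpan v hij).2)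
    · have : ¬ (x (.inl i) ≠ 0 ∨ x (.inr i) ≠ 0) := fun h' =>
        absurd (hmax i (by simpa using h')) (not_le.2 hij)
      push Not at this
      simp [this.1, this.2]
  have := eq_zero_of_quatCombination_mem (h j j.2).1 hmem
  simp [this.1, this.2] at hj

/-- The position of an index in the order `inl 0, inr 0, inl 1, inr 1, …`. -/
def quatKey : Fin n ⊕ Fin n → ℕ := Sum.elim (fun i => 2 * i) fun i => 2 * i + 1

theorem quatKey_injective : Function.Injective (quatKey (n := n)) := by
  rintro (i | i) (j | j) h <;> simp [quatKey] at h
  · rw [Fin.ext h]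
  · omega
  · omega
  · rw [Fin.ext h]

/-- Every quaternionic matrix is conjugate to a triangular one. -/
theorem exists_conj_blockTriangular (A : QuatMat n) :
    ∃ (g : (QuatMat n)ˣ) (T : QuatMat n), A = g * T * (g⁻¹ : (QuatMat n)ˣ) ∧
      (T : Matrix (Fin n ⊕ Fin n) (Fin n ⊕ Fin n) ℂ).BlockTriangular quatKey := by
  obtain ⟨v, hv⟩ := exists_isAdaptedFlag A.2 le_rfl
  have hunit := isUnit_quatColumns hv
  obtain ⟨g, hg⟩ := (QuatMat n).isUnit_of_isUnit_coe (a := ⟨_, quatColumns_mem v⟩) hunit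
  have hg' : ((g : QuatMat n) : Matrix (Fin n ⊕ Fin n) (Fin n ⊕ Fin n) ℂ) = quatColumns v :=
    congrArg Subtype.val hg
  set h : Matrix (Fin n ⊕ Fin n) (Fin n ⊕ Fin n) ℂ :=
    (((g⁻¹ : (QuatMat n)ˣ) : QuatMat n) : Matrix (Fin n ⊕ Fin n) (Fin n ⊕ Fin n) ℂ) with hh
  have hinv : h * quatColumns v = 1 := by
    rw [← hg', hh]
    exact congrArg Subtype.val g.inv_mul
  have hcol : ∀ q, h.mulVec (fun p => quatColumns v p q) = Pi.single q 1 := by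
    intro q
    have : (fun p => quatColumns v p q) = (quatColumns v).mulVec (Pi.single q 1) := by
      simp; rfl
    rw [this, Matrix.mulVec_mulVec, hinv, Matrix.one_mulVec]
  have hvcol : ∀ j : Fin n, h.mulVec (v j) = Pi.single (.inl j) 1 := fun j => hcol (.inl j)
  have hJcol : ∀ j : Fin n, h.mulVec (quatJ (v j)) = Pi.single (.inr j) 1 := fun j => hcol (.inr j)
  -- `h` sends the flag vectors to standard basis vectors, so vectors of `quatSpan v j` have image
  -- supported in positions below `2 * j`.
  have hspan : ∀ j : Fin n, ∀ w ∈ quatSpan v j, ∀ p, 2 * (j : ℕ) ≤ quatKey p →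
      h.mulVec w p = 0 := by
    intro j w hw p hp
    have hle : quatSpan v j ≤ LinearMap.ker
        ((LinearMap.proj p : ((Fin n ⊕ Fin n → ℂ) →ₗ[ℂ] ℂ)).comp h.mulVecLin) := by
      rw [quatSpan_le]
      intro i hi
      have hin : i < n := hi.trans j.2
      have e1 := hvcol ⟨i, hin⟩
      have e2 := hJcol ⟨i, hin⟩
      simp only [LinearMap.mem_ker, LinearMap.comp_apply, Matrix.mulVecLin_apply,
        LinearMap.proj_apply] at e1 e2 ⊢
      rw [e1, e2, Pi.single_apply, Pi.single_apply, if_neg, if_neg]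
      · exact ⟨rfl, rfl⟩
      · rintro rfl; simp [quatKey] at hp; omega
      · rintro rfl; simp [quatKey] at hp; omega
    exact hle hw
  refine ⟨g, (g⁻¹ : (QuatMat n)ˣ) * A * g, by simp [mul_assoc], ?_⟩
  set T : QuatMat n := (g⁻¹ : (QuatMat n)ˣ) * A * g with hT
  have hTmem := mem_quatMat_iff.1 T.2
  have hTl : ∀ p (j : Fin n), 2 * (j : ℕ) < quatKey p →
      (T : Matrix (Fin n ⊕ Fin n) (Fin n ⊕ Fin n) ℂ) p (.inl j) = 0 := by
    intro p j hp
    obtain ⟨c, hc⟩ := (hv j j.2).2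
    have e1 : (T : Matrix (Fin n ⊕ Fin n) (Fin n ⊕ Fin n) ℂ) p (.inl j) =
        h.mulVec ((A : Matrix (Fin n ⊕ Fin n) (Fin n ⊕ Fin n) ℂ).mulVec (v j)) p := by
      have : (T : Matrix (Fin n ⊕ Fin n) (Fin n ⊕ Fin n) ℂ) =
          h * ((A : Matrix (Fin n ⊕ Fin n) (Fin n ⊕ Fin n) ℂ) * quatColumns v) := by
        rw [hT, ← hg', ← mul_assoc]; rfl
      rw [this]; rfl
    have e2 : (A : Matrix (Fin n ⊕ Fin n) (Fin n ⊕ Fin n) ℂ).mulVec (v j) = c • v j +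
        ((A : Matrix (Fin n ⊕ Fin n) (Fin n ⊕ Fin n) ℂ).mulVec (v j) - c • v j) := by abel
    rw [e1, e2, Matrix.mulVec_add, Pi.add_apply, hspan j _ hc p hp.le, Matrix.mulVec_smul, hvcol,
      Pi.smul_apply, Pi.single_apply, if_neg]
    · simp
    · rintro rfl; simp [quatKey] at hp
  intro p q hpq
  -- The `inr` columns follow from the `inl` ones by the block symmetry. This uses that the entry at
  -- `inr j`, `inl j` vanishes too, since `v j` is an eigenvector modulo the earlier span.
  rcases q with j | j
  · exact hTl p j (by simpa [quatKey] using hpq)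
  · rcases p with i | i <;> simp only [quatKey, Sum.elim_inl, Sum.elim_inr] at hpq
    · rw [(hTmem i j).1, hTl (.inr i) j (by simp [quatKey]; omega)]; simp
    · rw [(hTmem i j).2, hTl (.inl i) j (by simp [quatKey]; omega)]; simp

end Triangularization

/-! ### Kronecker sums, and signs of coefficients -/

section KroneckerSum

namespace Matrix

theorem BlockTriangular.charpoly_eq_prod {R ι α : Type*} [CommRing R] [Fintype ι] [DecidableEq ι]
    [LinearOrder α] {b : ι → α} (hb : Function.Injective b) {M : Matrix ι ι R}
    (h : M.BlockTriangular b) :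
    M.charpoly = ∏ i, (Polynomial.X - Polynomial.C (M i i)) := by
  let _ : LinearOrder ι := LinearOrder.lift' b hb
  have : M.IsUpperTriangular := fun i j hij => h hij
  convert charpoly_of_isUpperTriangular M this

theorem BlockTriangular.mul_diag {R ι α : Type*} [CommRing R] [Fintype ι]
    [LinearOrder α] {b : ι → α} (hb : Function.Injective b) {M N : Matrix ι ι R}
    (hM : M.BlockTriangular b) (hN : N.BlockTriangular b) (i : ι) :
    (M * N) i i = M i i * N i i := by
  rw [mul_apply, Finset.sum_eq_single i]
  · intro j _ hj
    rcases lt_or_gt_of_ne (hb.ne hj) with h | h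
    · rw [hM h, zero_mul]
    · rw [hN h, mul_zero]
  · simp

theorem toLex_key_injective {ι α : Type*} {b : ι → α} (hb : Function.Injective b) :
    Function.Injective fun p : ι × ι => toLex (b p.1, b p.2) := by
  rintro ⟨i, j⟩ ⟨k, l⟩ h
  have := toLex.injective h
  simp only [Prod.mk.injEq] at this
  rw [hb this.1, hb this.2]

variable {R ι : Type*} [CommRing R] [DecidableEq ι]

/-- The matrix of `X ↦ A X + s X Aᵀ`, whose eigenvalues are the numbers `λ + s μ` for `λ`, `μ`
eigenvalues of `A`. -/
def kroneckerSum (s : ℤ) (A : Matrix ι ι R) : Matrix (ι × ι) (ι × ι) R :=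
  A ⊗ₖ (1 : Matrix ι ι R) + s • ((1 : Matrix ι ι R) ⊗ₖ A)

theorem kroneckerSum_apply (s : ℤ) (A : Matrix ι ι R) (p q : ι × ι) :
    kroneckerSum s A p q = A p.1 q.1 * (if p.2 = q.2 then 1 else 0) +
      s * ((if p.1 = q.1 then 1 else 0) * A p.2 q.2) := by
  simp only [kroneckerSum, add_apply, smul_apply, kroneckerMap_apply, one_apply]
  rw [zsmul_eq_mul]

theorem kroneckerSum_map {S : Type*} [CommRing S] (f : R →+* S) (s : ℤ) (A : Matrix ι ι R) :
    (kroneckerSum s A).map f = kroneckerSum s (A.map f) := by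
  ext p q
  simp only [map_apply, kroneckerSum_apply, map_add, map_mul, map_intCast]
  split_ifs <;> simp

variable {α : Type*} [LinearOrder α] {b : ι → α}

theorem BlockTriangular.kroneckerSum {T : Matrix ι ι R} (h : T.BlockTriangular b)
    (s : ℤ) : (kroneckerSum s T).BlockTriangular fun p => toLex (b p.1, b p.2) := by
  intro p q hpq
  rw [Prod.Lex.toLex_lt_toLex] at hpq
  rw [kroneckerSum_apply]
  rcases hpq with h1 | ⟨h1, h2⟩
  · have : p.1 ≠ q.1 := fun e => by rw [e] at h1; exact lt_irrefl _ h1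
    simp [h h1, this]
  · have : p.2 ≠ q.2 := fun e => by rw [e] at h2; exact lt_irrefl _ h2
    simp only at h2
    simp [h h2, this]

variable [Fintype ι]

/-- Conjugation by `g ⊗ g` works, because it fixes the identity in the idle factor of each summand.
-/
theorem kroneckerSum_conj (s : ℤ) (g : (Matrix ι ι R)ˣ) (A : Matrix ι ι R) :
    ∃ G : (Matrix (ι × ι) (ι × ι) R)ˣ,
      kroneckerSum s (g.val * A * g⁻¹.val) = G.val * kroneckerSum s A * G⁻¹.val := by
  refine ⟨⟨g.val ⊗ₖ g.val, g⁻¹.val ⊗ₖ g⁻¹.val, ?_, ?_⟩, ?_⟩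
  · rw [← mul_kronecker_mul, Units.mul_inv, one_kronecker_one]
  · rw [← mul_kronecker_mul, Units.inv_mul, one_kronecker_one]
  · change _ = (g.val ⊗ₖ g.val) * kroneckerSum s A * (g⁻¹.val ⊗ₖ g⁻¹.val)
    simp only [kroneckerSum, mul_add, add_mul, mul_smul_comm, smul_mul_assoc,
      ← mul_kronecker_mul, mul_one, Units.mul_inv]

theorem charpoly_conj_units {m : Type*} [Fintype m] [DecidableEq m] (G : (Matrix m m R)ˣ)
    (M : Matrix m m R) : (G.val * M * G⁻¹.val).charpoly = M.charpoly := by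
  rw [coe_units_inv, charpoly_units_conj]

theorem charpoly_kroneckerSum_conj (s : ℤ) (g : (Matrix ι ι R)ˣ) (A : Matrix ι ι R) :
    (kroneckerSum s (g.val * A * g⁻¹.val)).charpoly = (kroneckerSum s A).charpoly := by
  obtain ⟨G, hG⟩ := kroneckerSum_conj s g A
  rw [hG, charpoly_conj_units]

theorem charpoly_kroneckerSum_sq_conj (s : ℤ) (g : (Matrix ι ι R)ˣ) (A : Matrix ι ι R) :
    (kroneckerSum s (g.val * A * g⁻¹.val) ^ 2).charpoly = (kroneckerSum s A ^ 2).charpoly := by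
  obtain ⟨G, hG⟩ := kroneckerSum_conj s g A
  have : (G.val * kroneckerSum s A * G⁻¹.val) ^ 2 = G.val * kroneckerSum s A ^ 2 * G⁻¹.val := by
    rw [sq, sq]
    simp only [mul_assoc, Units.inv_mul_cancel_left]
  rw [hG, this, charpoly_conj_units]

theorem BlockTriangular.charpoly_kroneckerSum (hb : Function.Injective b) {T : Matrix ι ι R}
    (h : T.BlockTriangular b) (s : ℤ) : (Matrix.kroneckerSum s T).charpoly =
      ∏ p : ι × ι, (Polynomial.X - Polynomial.C (T p.1 p.1 + s * T p.2 p.2)) := by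
  rw [(h.kroneckerSum s).charpoly_eq_prod (toLex_key_injective hb)]
  simp [kroneckerSum_apply]

theorem BlockTriangular.charpoly_kroneckerSum_sq (hb : Function.Injective b) {T : Matrix ι ι R}
    (h : T.BlockTriangular b) (s : ℤ) : (Matrix.kroneckerSum s T ^ 2).charpoly =
      ∏ p : ι × ι, (Polynomial.X - Polynomial.C ((T p.1 p.1 + s * T p.2 p.2) ^ 2)) := by
  have h2 := h.kroneckerSum s
  rw [sq, (h2.mul h2).charpoly_eq_prod (toLex_key_injective hb)]
  simp [h2.mul_diag (toLex_key_injective hb) h2, kroneckerSum_apply, sq]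

end Matrix

theorem Polynomial.coeff_prod_X_add_C_nonneg {κ : Type*} (s : Finset κ) (r : κ → ℝ)
    (hr : ∀ i ∈ s, 0 ≤ r i) (k : ℕ) :
    0 ≤ (∏ i ∈ s, (Polynomial.X + Polynomial.C (r i))).coeff k := by
  classical
  induction s using Finset.induction_on generalizing k with
  | empty => simp only [Finset.prod_empty, Polynomial.coeff_one]; split_ifs <;> norm_num
  | insert a s ha ih =>
    have ih' := ih fun i hi => hr i (Finset.mem_insert_of_mem hi)
    rw [Finset.prod_insert ha, add_mul, Polynomial.coeff_add, Polynomial.coeff_C_mul]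
    refine add_nonneg ?_ (mul_nonneg (hr a (Finset.mem_insert_self a s)) (ih' k))
    rcases k with _ | k
    · simp
    · rw [Polynomial.coeff_X_mul]; exact ih' k

/-- A monic complex polynomial whose coefficients have nonnegative real parts has no positive
root. -/
theorem Polynomial.eval_ne_zero_of_coeff_re_nonneg {p : Polynomial ℂ} (hp : p.Monic)
    (h : ∀ k ≤ p.natDegree, 0 ≤ (p.coeff k).re) {x : ℝ} (hx : 0 < x) : p.eval (x : ℂ) ≠ 0 := by
  intro h0
  have hre : (p.eval (x : ℂ)).re =
      ∑ k ∈ Finset.range (p.natDegree + 1), (p.coeff k).re * x ^ k := by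
    rw [Polynomial.eval_eq_sum_range, Complex.re_sum]
    refine Finset.sum_congr rfl fun k _ => ?_
    rw [← Complex.ofReal_pow, Complex.re_mul_ofReal]
  rw [h0, Finset.sum_range_succ, hp.coeff_natDegree] at hre
  have h1 : 0 ≤ ∑ k ∈ Finset.range p.natDegree, (p.coeff k).re * x ^ k :=
    Finset.sum_nonneg fun k hk =>
      mul_nonneg (h k (Finset.mem_range.1 hk).le) (pow_nonneg hx.le k)
  have h2 : 0 < x ^ p.natDegree := pow_pos hx _
  simp at hre
  linarith

end KroneckerSum

/-! ### The spectral conditions in terms of coefficients -/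

section SpectralConditions

variable {n : ℕ}

/-- The underlying complex matrix of an invertible quaternionic matrix. -/
noncomputable def quatUnit (g : (QuatMat n)ˣ) : (Matrix (Fin n ⊕ Fin n) (Fin n ⊕ Fin n) ℂ)ˣ :=
  Units.map (QuatMat n).val.toMonoidHom g

theorem coe_conj (g : (QuatMat n)ˣ) (T : QuatMat n) :
    ((g * T * (g⁻¹ : (QuatMat n)ˣ) : QuatMat n) : Matrix (Fin n ⊕ Fin n) (Fin n ⊕ Fin n) ℂ) =
      (quatUnit g).val * T * (quatUnit g)⁻¹.val := rfl

/-- The triangular quaternionic matrices. -/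
noncomputable def quatTriangular (n : ℕ) : Subalgebra ℝ (QuatMat n) where
  carrier := {T | (T : Matrix (Fin n ⊕ Fin n) (Fin n ⊕ Fin n) ℂ).BlockTriangular quatKey}
  mul_mem' h1 h2 := h1.mul h2
  add_mem' h1 h2 := h1.add h2
  algebraMap_mem' r := by
    intro i j hij
    have : i ≠ j := fun e => by rw [e] at hij; exact lt_irrefl _ hij
    change (algebraMap ℝ (Matrix (Fin n ⊕ Fin n) (Fin n ⊕ Fin n) ℂ) r) i j = 0
    rw [Matrix.algebraMap_matrix_apply, if_neg this]

/-- The diagonal entries of a quaternionic matrix. -/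
def quatDiag (T : QuatMat n) (p : Fin n ⊕ Fin n) : ℂ :=
  (T : Matrix (Fin n ⊕ Fin n) (Fin n ⊕ Fin n) ℂ) p p

theorem quatDiag_inr (T : QuatMat n) (j : Fin n) :
    quatDiag T (.inr j) = conj (quatDiag T (.inl j)) := (mem_quatMat_iff.1 T.2 j j).2

theorem charpoly_of_conj (g : (QuatMat n)ˣ) {T : QuatMat n} (hT : T ∈ quatTriangular n) :
    ((g * T * (g⁻¹ : (QuatMat n)ˣ) : QuatMat n) :
      Matrix (Fin n ⊕ Fin n) (Fin n ⊕ Fin n) ℂ).charpoly =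
      ∏ p, (Polynomial.X - Polynomial.C (quatDiag T p)) := by
  rw [coe_conj, Matrix.charpoly_conj_units]
  exact Matrix.BlockTriangular.charpoly_eq_prod quatKey_injective hT

theorem hasPurelyImaginarySpectrum_conj_iff (g : (QuatMat n)ˣ) {T : QuatMat n}
    (hT : T ∈ quatTriangular n) :
    HasPurelyImaginarySpectrum (g * T * (g⁻¹ : (QuatMat n)ˣ) : QuatMat n) ↔
      ∀ j : Fin n, (quatDiag T (.inl j)).re = 0 := by
  have h : HasPurelyImaginarySpectrum (g * T * (g⁻¹ : (QuatMat n)ˣ) : QuatMat n) ↔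
      ∀ p, (quatDiag T p).re = 0 := by
    unfold HasPurelyImaginarySpectrum
    simp only [Matrix.mem_spectrum_iff_isRoot_charpoly, charpoly_of_conj g hT, Polynomial.IsRoot,
      Polynomial.eval_prod, Finset.prod_eq_zero_iff]
    constructor
    · exact fun h p => h _ ⟨p, Finset.mem_univ p, by simp⟩
    · rintro h z ⟨p, -, hp⟩
      have : z = quatDiag T p := by simpa [sub_eq_zero] using hp
      rw [this]; exact h p
  rw [h]
  constructor
  · exact fun h j => h _
  · rintro h (j | j)
    · exact h j
    · rw [quatDiag_inr, Complex.conj_re]; exact h j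

theorem hasNoRepeatedEigenvalues_conj_iff (g : (QuatMat n)ˣ) {T : QuatMat n}
    (hT : T ∈ quatTriangular n) :
    HasNoRepeatedEigenvalues (g * T * (g⁻¹ : (QuatMat n)ˣ) : QuatMat n) ↔
      Function.Injective (quatDiag T) := by
  unfold HasNoRepeatedEigenvalues
  rw [charpoly_of_conj g hT, Polynomial.roots_prod _ _
    (Finset.prod_ne_zero_iff.2 fun p _ => Polynomial.X_sub_C_ne_zero _)]
  simp only [Polynomial.roots_X_sub_C]
  rw [Multiset.bind_singleton, Multiset.nodup_map_iff_inj_on Finset.univ.nodup]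
  constructor
  · exact fun h p q hpq => h p (Finset.mem_univ p) q (Finset.mem_univ q) hpq
  · exact fun h p _ q _ hpq => h hpq

/-- For eigenvalues `i a`, `i b` the factor is `X + (a + b)²`, and products of such factors have
nonnegative coefficients. Conversely, an eigenvalue `λ` with `Re λ ≠ 0` comes with `conj λ`, and `(λ
+ conj λ)²` is a positive root, which those signs exclude. -/
theorem hasPurelyImaginarySpectrum_iff (A : QuatMat n) :
    HasPurelyImaginarySpectrum A ↔ ∀ k : Fin ((2 * n) ^ 2 + 1),
      0 ≤ ((Matrix.kroneckerSum 1 (A : Matrix (Fin n ⊕ Fin n) (Fin n ⊕ Fin n) ℂ) ^ 2).charpoly.coeff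
        k).re := by
  obtain ⟨g, T, rfl, hT⟩ := exists_conj_blockTriangular A
  rw [hasPurelyImaginarySpectrum_conj_iff g hT, coe_conj, Matrix.charpoly_kroneckerSum_sq_conj,
    hT.charpoly_kroneckerSum_sq quatKey_injective]
  set P : Polynomial ℂ := ∏ p : (Fin n ⊕ Fin n) × (Fin n ⊕ Fin n), (Polynomial.X - Polynomial.C
    (((T : Matrix (Fin n ⊕ Fin n) (Fin n ⊕ Fin n) ℂ) p.1 p.1 +
      ((1 : ℤ) : ℂ) * (T : Matrix (Fin n ⊕ Fin n) (Fin n ⊕ Fin n) ℂ) p.2 p.2) ^ 2)) with hP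
  constructor
  · intro h k
    have hre : ∀ p, (quatDiag T p).re = 0 := by
      rintro (j | j)
      · exact h j
      · rw [quatDiag_inr, Complex.conj_re]; exact h j
    have : P = (∏ p : (Fin n ⊕ Fin n) × (Fin n ⊕ Fin n), (Polynomial.X + Polynomial.C
        (((quatDiag T p.1).im + (quatDiag T p.2).im) ^ 2))).map Complex.ofRealHom := by
      rw [hP, Polynomial.map_prod]
      refine Finset.prod_congr rfl fun p _ => ?_
      have e : ∀ q, (T : Matrix (Fin n ⊕ Fin n) (Fin n ⊕ Fin n) ℂ) q q =
          (quatDiag T q).im * Complex.I := by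
        intro q
        apply Complex.ext
        · simpa [quatDiag] using hre q
        · simp [quatDiag]
      rw [e p.1, e p.2, Polynomial.map_add, Polynomial.map_X, Polynomial.map_C, sub_eq_add_neg,
        ← Polynomial.C_neg]
      congr 2
      simp only [Int.cast_one, one_mul, Complex.ofRealHom_eq_coe]
      push_cast
      rw [← add_mul, mul_pow, Complex.I_sq]
      ring
    rw [this, Polynomial.coeff_map, Complex.ofRealHom_eq_coe, Complex.ofReal_re]
    exact Polynomial.coeff_prod_X_add_C_nonneg _ _ (fun p _ => sq_nonneg _) k
  · intro h j
    by_contra hne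
    have hmon : P.Monic := Polynomial.monic_prod_X_sub_C _ _
    have hdeg : P.natDegree = (2 * n) ^ 2 := by
      rw [hP, Polynomial.natDegree_prod_of_monic _ _ fun p _ => Polynomial.monic_X_sub_C _]
      simp only [Polynomial.natDegree_X_sub_C]
      simp
      ring
    have hpos : 0 < (2 * (quatDiag T (.inl j)).re) ^ 2 := by positivity
    refine Polynomial.eval_ne_zero_of_coeff_re_nonneg hmon
      (fun k hk => h ⟨k, by omega⟩) hpos ?_
    rw [hP, Polynomial.eval_prod]
    refine Finset.prod_eq_zero (Finset.mem_univ ((.inl j, .inr j) :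
      (Fin n ⊕ Fin n) × (Fin n ⊕ Fin n))) ?_
    have e := quatDiag_inr T j
    simp only [quatDiag] at e ⊢
    rw [Polynomial.eval_sub, Polynomial.eval_X, Polynomial.eval_C, e, Int.cast_one, one_mul,
      Complex.add_conj]
    push_cast
    ring

/-- The `2n` diagonal pairs contribute `X ^ (2 * n)`, so this coefficient is the constant term of
the remaining product: up to sign, the product of all `λ_p - λ_q` with `p ≠ q`. -/
theorem hasNoRepeatedEigenvalues_iff (A : QuatMat n) :
    HasNoRepeatedEigenvalues A ↔
      (Matrix.kroneckerSum (-1) (A : Matrix (Fin n ⊕ Fin n) (Fin n ⊕ Fin n) ℂ)).charpoly.coeff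
        (2 * n) ≠ 0 := by
  obtain ⟨g, T, rfl, hT⟩ := exists_conj_blockTriangular A
  rw [hasNoRepeatedEigenvalues_conj_iff g hT, coe_conj, Matrix.charpoly_kroneckerSum_conj,
    hT.charpoly_kroneckerSum quatKey_injective]
  have hsplit : ∏ p : (Fin n ⊕ Fin n) × (Fin n ⊕ Fin n), (Polynomial.X - Polynomial.C
      ((T : Matrix (Fin n ⊕ Fin n) (Fin n ⊕ Fin n) ℂ) p.1 p.1 +
      ((-1 : ℤ) : ℂ) * (T : Matrix (Fin n ⊕ Fin n) (Fin n ⊕ Fin n) ℂ) p.2 p.2)) =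
      (∏ p ∈ (Finset.univ : Finset (Fin n ⊕ Fin n)).offDiag, (Polynomial.X - Polynomial.C
        (quatDiag T p.1 - quatDiag T p.2))) * Polynomial.X ^ (2 * n) := by
    rw [← Finset.univ_product_univ, ← Finset.diag_union_offDiag,
      Finset.prod_union (Finset.disjoint_diag_offDiag _), mul_comm, Finset.prod_diag]
    congr 1
    · refine Finset.prod_congr rfl fun p _ => ?_
      simp [quatDiag, sub_eq_add_neg]
    · simp [two_mul]
  rw [hsplit, Polynomial.coeff_mul_X_pow', if_pos le_rfl, Nat.sub_self,
    Polynomial.coeff_zero_eq_eval_zero, Polynomial.eval_prod, Finset.prod_ne_zero_iff]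
  constructor
  · rintro h ⟨p, q⟩ hpq
    rw [Finset.mem_offDiag] at hpq
    simpa [sub_eq_zero] using h.ne hpq.2.2.symm
  · intro h p q hpq
    by_contra hne
    exact h (p, q) (by simp [hne]) (by simp [hpq])

end SpectralConditions

/-! ### Complex-valued polynomial functions -/

section ComplexPolynomialFunctions

/-- Complex-valued functions whose real and imaginary parts are polynomial. -/
noncomputable def complexPolyFun (E : Type*) [NormedAddCommGroup E] [NormedSpace ℝ E] :
    Subring (E → ℂ) where
  carrier := {f | (fun x => (f x).re) ∈ polyFun E ∧ (fun x => (f x).im) ∈ polyFun E}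
  mul_mem' := by
    rintro f g ⟨hf1, hf2⟩ ⟨hg1, hg2⟩
    exact ⟨sub_mem (mul_mem hf1 hg1) (mul_mem hf2 hg2), add_mem (mul_mem hf1 hg2) (mul_mem hf2 hg1)⟩
  one_mem' := ⟨one_mem _, zero_mem _⟩
  add_mem' := by
    rintro f g ⟨hf1, hf2⟩ ⟨hg1, hg2⟩
    exact ⟨add_mem hf1 hg1, add_mem hf2 hg2⟩
  zero_mem' := ⟨zero_mem _, zero_mem _⟩
  neg_mem' := by
    rintro f ⟨hf1, hf2⟩
    exact ⟨neg_mem hf1, neg_mem hf2⟩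

variable {E : Type*} [NormedAddCommGroup E] [NormedSpace ℝ E]

/-- Evaluation at a point. -/
noncomputable def complexPolyFun.ev (x : E) : complexPolyFun E →+* ℂ :=
  (Pi.evalRingHom (fun _ : E => ℂ) x).comp (complexPolyFun E).subtype

variable [FiniteDimensional ℝ E]

theorem LinearMap.mem_complexPolyFun (φ : E →ₗ[ℝ] ℂ) : (φ : E → ℂ) ∈ complexPolyFun E :=
  ⟨(Complex.reCLM.comp (LinearMap.toContinuousLinearMap φ)).mem_polyFun,
    (Complex.imCLM.comp (LinearMap.toContinuousLinearMap φ)).mem_polyFun⟩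

end ComplexPolynomialFunctions

/-! ### Conjugation as a linear automorphism -/

section Conjugation

variable {𝔸 : Type*} [NormedRing 𝔸] [NormedAlgebra ℝ 𝔸]

/-- Conjugation by a unit of a normed algebra. -/
def conjCLE (C : 𝔸ˣ) : 𝔸 ≃L[ℝ] 𝔸 where
  toFun A := C * A * (C⁻¹ : 𝔸ˣ)
  invFun A := (C⁻¹ : 𝔸ˣ) * A * C
  map_add' A B := by rw [mul_add, add_mul]
  map_smul' r A := by simp
  left_inv A := by simp [mul_assoc]
  right_inv A := by simp [mul_assoc]
  continuous_toFun := by fun_prop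
  continuous_invFun := by fun_prop

theorem conjCLE_apply (C : 𝔸ˣ) (A : 𝔸) : conjCLE C A = C * A * (C⁻¹ : 𝔸ˣ) := rfl

theorem conjCLE_symm (C : 𝔸ˣ) : (conjCLE C).symm = conjCLE C⁻¹ := by
  ext A
  rw [ContinuousLinearEquiv.symm_apply_eq, conjCLE_apply, conjCLE_apply]
  simp [mul_assoc]

end Conjugation

/-! ### Polynomial invariants, and strata with repeated eigenvalues -/

section ConjugationInvariants

variable {n : ℕ}

/-- The matrix of coordinate functions. -/
noncomputable def genericQuatMat (n : ℕ) :
    Matrix (Fin n ⊕ Fin n) (Fin n ⊕ Fin n) (complexPolyFun (QuatMat n)) :=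
  Matrix.of fun p q => ⟨_, LinearMap.mem_complexPolyFun
    ((Matrix.entryLinearMap ℝ ℂ p q).comp (QuatMat n).val.toLinearMap)⟩

theorem genericQuatMat_map (A : QuatMat n) :
    (genericQuatMat n).map (complexPolyFun.ev A) = A := by
  ext p q; rfl

/-- The coefficients whose nonnegativity characterizes a purely imaginary spectrum. -/
noncomputable def imagCoeff (n k : ℕ) : complexPolyFun (QuatMat n) :=
  (Matrix.kroneckerSum 1 (genericQuatMat n) ^ 2).charpoly.coeff k

/-- A nonzero multiple of the squared product of the differences of the eigenvalues. -/
noncomputable def discrCoeff (n : ℕ) : complexPolyFun (QuatMat n) :=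
  (Matrix.kroneckerSum (-1) (genericQuatMat n)).charpoly.coeff (2 * n)

theorem imagCoeff_apply (k : ℕ) (A : QuatMat n) : (imagCoeff n k : QuatMat n → ℂ) A =
    (Matrix.kroneckerSum 1 (A : Matrix (Fin n ⊕ Fin n) (Fin n ⊕ Fin n) ℂ) ^ 2).charpoly.coeff
      k := by
  change complexPolyFun.ev A (imagCoeff n k) = _
  rw [imagCoeff, ← Polynomial.coeff_map, ← Matrix.charpoly_map, Matrix.map_pow,
    Matrix.kroneckerSum_map, genericQuatMat_map]

theorem discrCoeff_apply (A : QuatMat n) : (discrCoeff n : QuatMat n → ℂ) A =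
    (Matrix.kroneckerSum (-1) (A : Matrix (Fin n ⊕ Fin n) (Fin n ⊕ Fin n) ℂ)).charpoly.coeff
      (2 * n) := by
  change complexPolyFun.ev A (discrCoeff n) = _
  rw [discrCoeff, ← Polynomial.coeff_map, ← Matrix.charpoly_map, Matrix.kroneckerSum_map,
    genericQuatMat_map]

theorem isStable_range_conjCLE {S : Set (QuatMat n)} :
    IsStable (range conjCLE) S ↔ IsConjugacyInvariant S :=
  ⟨fun h C A hA => h _ ⟨C, rfl⟩ A hA, by rintro h _ ⟨C, rfl⟩ A hA; exact h C A hA⟩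

theorem imagCoeff_conj (k : ℕ) (C : (QuatMat n)ˣ) (A : QuatMat n) :
    (imagCoeff n k : QuatMat n → ℂ) (conjCLE C A) = (imagCoeff n k : QuatMat n → ℂ) A := by
  rw [imagCoeff_apply, imagCoeff_apply, conjCLE_apply, coe_conj,
    Matrix.charpoly_kroneckerSum_sq_conj]

theorem discrCoeff_conj (C : (QuatMat n)ˣ) (A : QuatMat n) :
    (discrCoeff n : QuatMat n → ℂ) (conjCLE C A) = (discrCoeff n : QuatMat n → ℂ) A := by
  rw [discrCoeff_apply, discrCoeff_apply, conjCLE_apply, coe_conj,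
    Matrix.charpoly_kroneckerSum_conj]

theorem hasPurelyImaginarySpectrum_conj (C : (QuatMat n)ˣ) (A : QuatMat n) :
    HasPurelyImaginarySpectrum (conjCLE C A) ↔ HasPurelyImaginarySpectrum A := by
  rw [hasPurelyImaginarySpectrum_iff, hasPurelyImaginarySpectrum_iff]
  simp only [← imagCoeff_apply, imagCoeff_conj]

theorem hasNoRepeatedEigenvalues_conj (C : (QuatMat n)ˣ) (A : QuatMat n) :
    HasNoRepeatedEigenvalues (conjCLE C A) ↔ HasNoRepeatedEigenvalues A := by
  rw [hasNoRepeatedEigenvalues_iff, hasNoRepeatedEigenvalues_iff, ← discrCoeff_apply,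
    ← discrCoeff_apply, discrCoeff_conj]

/-- The matrices with a purely imaginary spectrum and a repeated eigenvalue form a finite disjoint
union of conjugation-invariant submanifolds. -/
theorem hasStratification_repeated (n : ℕ) : HasStratification (range conjCLE)
    {A : QuatMat n | HasPurelyImaginarySpectrum A ∧ ¬ HasNoRepeatedEigenvalues A} := by
  have hsymm : ∀ g ∈ range (conjCLE (𝔸 := QuatMat n)),
      g.symm ∈ range (conjCLE (𝔸 := QuatMat n)) := by
    rintro _ ⟨C, rfl⟩
    exact ⟨C⁻¹, (conjCLE_symm C).symm⟩
  let D : Set (polyFun (QuatMat n)) := {⟨_, (discrCoeff n).2.1⟩, ⟨_, (discrCoeff n).2.2⟩}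
  have hD : ∀ A : QuatMat n, (∀ f ∈ D, (f : QuatMat n → ℝ) A = 0) ↔
      ¬ HasNoRepeatedEigenvalues A := by
    intro A
    rw [hasNoRepeatedEigenvalues_iff, ← discrCoeff_apply, not_not, Complex.ext_iff]
    simp [D]
  have h := (isPolyClosed_setOf D).hasStratification_nonneg hsymm (fun g hg A hA => by
      obtain ⟨C, rfl⟩ := hg
      refine (hD _).2 ?_
      rw [hasNoRepeatedEigenvalues_conj]
      exact (hD _).1 hA)
    (κ := Fin ((2 * n) ^ 2 + 1)) (fun k => ⟨_, (imagCoeff n k).2.1⟩) (by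
      rintro _ ⟨C, rfl⟩ k A
      change ((imagCoeff n k : QuatMat n → ℂ) (conjCLE C A)).re = _
      rw [imagCoeff_conj])
  refine (congrArg (HasStratification _) (Set.ext fun A => ?_)).mpr h
  simp only [mem_ofPred_eq]
  rw [hD, and_comm, hasPurelyImaginarySpectrum_iff]
  simp only [← imagCoeff_apply]

end ConjugationInvariants

/-! ### Charts and dimension bounds from conjugation -/

section ConjugationCharts

variable {𝔸 : Type*} [NormedRing 𝔸] [NormedAlgebra ℝ 𝔸]

theorem isOpen_isUnit_one_add [CompleteSpace 𝔸] (ρ : 𝔸 →L[ℝ] 𝔸) :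
    IsOpen {a : 𝔸 | IsUnit (1 + ρ a)} :=
  Units.isOpen.preimage (by fun_prop : Continuous fun a => 1 + ρ a)

theorem contDiffAt_ringInverse_of_isUnit [CompleteSpace 𝔸] {a : 𝔸} (ha : IsUnit a) :
    ContDiffAt ℝ ∞ (Ring.inverse : 𝔸 → 𝔸) a := by
  obtain ⟨u, rfl⟩ := ha
  exact contDiffAt_ringInverse ℝ u

/-- For a projection `π` onto a subalgebra: the conjugate of `π a` by `1 + (a - π a)`. -/
noncomputable def conjParam (π : 𝔸 →L[ℝ] 𝔸) (a : 𝔸) : 𝔸 :=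
  (1 + (ContinuousLinearMap.id ℝ 𝔸 - π) a) * π a *
    Ring.inverse (1 + (ContinuousLinearMap.id ℝ 𝔸 - π) a)

theorem contDiffOn_conjParam [CompleteSpace 𝔸] (π : 𝔸 →L[ℝ] 𝔸) :
    ContDiffOn ℝ ∞ (conjParam π) {a | IsUnit (1 + (ContinuousLinearMap.id ℝ 𝔸 - π) a)} := by
  intro a ha
  refine ContDiffAt.contDiffWithinAt (ContDiffAt.mul (by fun_prop) ?_)
  exact (contDiffAt_ringInverse_of_isUnit ha).comp a
    (f := fun a => 1 + (ContinuousLinearMap.id ℝ 𝔸 - π) a) (by fun_prop)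

/-- At `T` the conjugating factor is `1`, so to first order it acts through the commutator with `T`.
-/
theorem hasFDerivAt_conjParam [CompleteSpace 𝔸] (π : 𝔸 →L[ℝ] 𝔸) {T : 𝔸} (hT : π T = T) :
    ∃ L : 𝔸 →L[ℝ] 𝔸, HasFDerivAt (conjParam π) L T ∧
      ∀ v, L v = (v - π v) * T - T * (v - π v) + π v := by
  set ρ := ContinuousLinearMap.id ℝ 𝔸 - π with hρ
  have hρT : ρ T = 0 := by simp [hρ, hT]
  have h1 : HasFDerivAt (fun a => 1 + ρ a) ρ T := ρ.hasFDerivAt.const_add 1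
  have h2 : HasFDerivAt (fun a => Ring.inverse (1 + ρ a))
      ((-ContinuousLinearMap.mulLeftRight ℝ 𝔸 1 1).comp ρ) T := by
    refine HasFDerivAt.comp (g := Ring.inverse)
      (g' := -ContinuousLinearMap.mulLeftRight ℝ 𝔸 1 1) T ?_ h1
    rw [hρT, add_zero]
    simpa using hasFDerivAt_ringInverse (𝕜 := ℝ) (1 : 𝔸ˣ)
  refine ⟨_, (h1.mul' π.hasFDerivAt).mul' h2, fun v => ?_⟩
  simp [hT, hρ]
  noncomm_ring

variable [FiniteDimensional ℝ 𝔸]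

theorem exists_projection (𝔟 : Subalgebra ℝ 𝔸) :
    ∃ π : 𝔸 →L[ℝ] 𝔸, (∀ a, π a ∈ 𝔟) ∧ ∀ b ∈ 𝔟, π b = b := by
  obtain ⟨f, hf⟩ := 𝔟.toSubmodule.subtype.exists_leftInverse_of_injective (Submodule.ker_subtype _)
  refine ⟨LinearMap.toContinuousLinearMap (𝔟.toSubmodule.subtype.comp f), fun a => (f a).2,
    fun b hb => ?_⟩
  exact congrArg Subtype.val (LinearMap.congr_fun hf ⟨b, hb⟩)

/-- The hypothesis `hreg` says that the commutator with `T` is injective modulo `𝔟`; it makes the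
derivative of `conjParam π` invertible. In this chart, membership in an invariant set depends only
on the component `π a` in `𝔟`. -/
theorem isEmbeddedAt_conj {π : 𝔸 →L[ℝ] 𝔸} {𝔟 : Subalgebra ℝ 𝔸} (hπ : ∀ a, π a ∈ 𝔟)
    (hπ' : ∀ b ∈ 𝔟, π b = b) {T : 𝔸} (hT : T ∈ 𝔟) (hreg : ∀ x, x * T - T * x ∈ 𝔟 → x ∈ 𝔟)
    {U : Set 𝔸} (hU : IsOpen U) (hTU : T ∈ U) {S : Set 𝔸} (V : Submodule ℝ 𝔸)
    (hS : ∀ (g : 𝔸ˣ) (t : 𝔸), t ∈ 𝔟 → t ∈ U → (conjCLE g t ∈ S ↔ t ∈ V))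
    (hV : ∀ a, π a ∈ V ↔ a ∈ V) (g : 𝔸ˣ) :
    IsEmbeddedAt (Module.finrank ℝ V) S (conjCLE g T) := by
  have : CompleteSpace 𝔸 := FiniteDimensional.complete ℝ 𝔸
  obtain ⟨L, hL, hLv⟩ := hasFDerivAt_conjParam π (hπ' T hT)
  have hinj : Function.Injective L := by
    refine (injective_iff_map_eq_zero L).2 fun v hv => ?_
    rw [hLv] at hv
    have h1 : v - π v ∈ 𝔟 := by
      refine hreg _ ?_
      rw [eq_neg_of_add_eq_zero_left hv]
      exact neg_mem (hπ v)
    have h2 : v ∈ 𝔟 := by simpa using add_mem h1 (hπ v)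
    rw [hπ' v h2] at hv
    simpa using hv
  let L' : 𝔸 ≃L[ℝ] 𝔸 :=
    (LinearEquiv.ofInjectiveEndo (L : 𝔸 →ₗ[ℝ] 𝔸) hinj).toContinuousLinearEquiv
  have hL' : (L' : 𝔸 →L[ℝ] 𝔸) = L := by ext v; rfl
  have h1 : HasFDerivAt (fun a => conjCLE g (conjParam π a))
      ((L'.trans (conjCLE g) : 𝔸 ≃L[ℝ] 𝔸) : 𝔸 →L[ℝ] 𝔸) T := by
    have := (conjCLE g).hasFDerivAt.comp T hL
    rw [← hL'] at this
    exact this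
  have hTT : conjParam π T = T := by simp [conjParam, hπ' T hT]
  have := isEmbeddedAt_of_parametrization (f := fun a => conjCLE g (conjParam π a)) (S := S)
    ((isOpen_isUnit_one_add (ContinuousLinearMap.id ℝ 𝔸 - π)).inter (hU.preimage π.continuous))
    (a := T) ⟨by simp [hπ' T hT], by rw [mem_preimage, hπ' T hT]; exact hTU⟩
    ((conjCLE g).contDiff.comp_contDiffOn ((contDiffOn_conjParam π).mono inter_subset_left)) h1 V
    (fun a ha => by
      obtain ⟨u, hu⟩ := ha.1
      have e : conjCLE g (conjParam π a) = conjCLE (g * u) (π a) := by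
        rw [conjParam, ← hu, Ring.inverse_unit, conjCLE_apply, conjCLE_apply]
        simp [mul_assoc]
      rw [e, hS _ _ (hπ a) ha.2, hV])
  rwa [hTT] at this

/-- The product has derivative the identity at `a = 0`, so the inverse function theorem applies. For
a projection onto a subalgebra this factors every element near `1` into a transversal part and a
unit lying in the subalgebra. -/
theorem mem_nhds_one_of_projection {π : 𝔸 →L[ℝ] 𝔸} :
    {w : 𝔸 | ∃ a : 𝔸, ‖a - π a‖ < 1 ∧ IsUnit (1 + π a) ∧ w = (1 + (a - π a)) * (1 + π a)} ∈
      𝓝 (1 : 𝔸) := by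
  have : CompleteSpace 𝔸 := FiniteDimensional.complete ℝ 𝔸
  let F : 𝔸 → 𝔸 := fun a => (1 + (a - π a)) * (1 + π a)
  have hF : HasStrictFDerivAt F ((ContinuousLinearEquiv.refl ℝ 𝔸 : 𝔸 ≃L[ℝ] 𝔸) : 𝔸 →L[ℝ] 𝔸) 0 := by
    have h1 : HasStrictFDerivAt (fun a => 1 + (a - π a)) (ContinuousLinearMap.id ℝ 𝔸 - π) 0 :=
      ((hasStrictFDerivAt_id 0).sub π.hasStrictFDerivAt).const_add 1
    have h2 : HasStrictFDerivAt (fun a => 1 + π a) π 0 := π.hasStrictFDerivAt.const_add 1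
    refine (h1.mul' h2).congr_fderiv ?_
    ext v
    simp
  have hmap := hF.map_nhds_eq_of_equiv
  have hF0 : F 0 = 1 := by simp [F]
  rw [hF0] at hmap
  rw [← hmap, mem_map]
  have e1 : ∀ᶠ a in 𝓝 (0 : 𝔸), ‖a - π a‖ < 1 := by
    have : Continuous fun a : 𝔸 => ‖a - π a‖ := by fun_prop
    exact this.continuousAt.eventually_lt continuousAt_const (by simp)
  have e2 : ∀ᶠ a in 𝓝 (0 : 𝔸), IsUnit (1 + π a) :=
    (isOpen_isUnit_one_add π).mem_nhds (by simp)
  filter_upwards [e1, e2] with a h1 h2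
  exact ⟨a, h1, h2, rfl⟩

/-- A bound for the dimension of the set of conjugates of a linear subspace `W` that is stable
under conjugation by the units of a subalgebra. -/
theorem dimH_conjugates_le {𝔟 : Subalgebra ℝ 𝔸} {W : Submodule ℝ 𝔸}
    (hW : ∀ b : 𝔸ˣ, (b : 𝔸) ∈ 𝔟 → ∀ t ∈ W, conjCLE b t ∈ W) :
    dimH {A : 𝔸 | ∃ g : 𝔸ˣ, ∃ t ∈ W, A = conjCLE g t} ≤
      (Module.finrank ℝ 𝔸 - Module.finrank ℝ 𝔟 + Module.finrank ℝ W : ℕ) := by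
  have : CompleteSpace 𝔸 := FiniteDimensional.complete ℝ 𝔸
  obtain ⟨π, hπ, hπ'⟩ := exists_projection 𝔟
  let N : Submodule ℝ 𝔸 := LinearMap.ker (π : 𝔸 →ₗ[ℝ] 𝔸)
  have hN : Module.finrank ℝ N = Module.finrank ℝ 𝔸 - Module.finrank ℝ 𝔟 := by
    have h1 := LinearMap.finrank_range_add_finrank_ker (π : 𝔸 →ₗ[ℝ] 𝔸)
    have h2 : LinearMap.range (π : 𝔸 →ₗ[ℝ] 𝔸) = 𝔟.toSubmodule := by
      ext b
      exact ⟨by rintro ⟨a, rfl⟩; exact hπ a, fun hb => ⟨b, hπ' b hb⟩⟩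
    rw [h2] at h1
    change Module.finrank ℝ 𝔟 + Module.finrank ℝ N = _ at h1
    omega
  let Θ : 𝔸 → N × W → 𝔸 := fun d p =>
    d * ((1 + (p.1 : 𝔸)) * (p.2 : 𝔸) * Ring.inverse (1 + (p.1 : 𝔸))) * Ring.inverse d
  let s : Set (N × W) := {p | ‖p.1‖ < 1}
  have hunit : ∀ x : 𝔸, ‖x‖ < 1 → IsUnit (1 + x) := fun x hx => by
    have := isUnit_one_sub_of_norm_lt_one (x := -x) (by rwa [norm_neg])
    rwa [sub_neg_eq_add] at this
  have hsc : Convex ℝ s := by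
    have : s = (Metric.ball (0 : N) 1) ×ˢ univ := by ext p; simp [s]
    rw [this]
    exact (convex_ball 0 1).prod convex_univ
  have hΘ : ∀ d, ContDiffOn ℝ 1 (Θ d) s := by
    intro d p hp
    refine ContDiffAt.contDiffWithinAt ?_
    have hcoe1 : ContDiffAt ℝ 1 (fun p : N × W => (p.1 : 𝔸)) p :=
      (N.subtypeL.contDiff.comp contDiff_fst).contDiffAt
    have hcoe2 : ContDiffAt ℝ 1 (fun p : N × W => (p.2 : 𝔸)) p :=
      (W.subtypeL.contDiff.comp contDiff_snd).contDiffAt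
    have hinv : ContDiffAt ℝ 1 (fun p : N × W => Ring.inverse (1 + (p.1 : 𝔸))) p :=
      ((contDiffAt_ringInverse_of_isUnit (hunit (p.1 : 𝔸) hp)).of_le (by simp)).comp p
        (f := fun p : N × W => 1 + (p.1 : 𝔸)) (contDiffAt_const.add hcoe1)
    exact (contDiffAt_const.mul (((contDiffAt_const.add hcoe1).mul hcoe2).mul hinv)).mul
      contDiffAt_const
  -- For `d` in a dense set and close to `g`, the quotient `d⁻¹ g` factors as `(1 + N) b` with `b`
  -- in `𝔟`, and `b` is absorbed by the stability of `W`. Countably many `d` suffice, and countable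
  -- unions do not raise Hausdorff dimension.
  obtain ⟨D, hDc, hDd⟩ := TopologicalSpace.exists_countable_dense 𝔸
  have hcover : {A : 𝔸 | ∃ g : 𝔸ˣ, ∃ t ∈ W, A = conjCLE g t} ⊆ ⋃ d ∈ D, Θ d '' s := by
    rintro _ ⟨g, t, ht, rfl⟩
    have hΩ := mem_nhds_one_of_projection (π := π)
    have hcont : ContinuousAt (fun h : 𝔸 => Ring.inverse h * g) g :=
      (NormedRing.inverse_continuousAt g).mul continuousAt_const
    have h1 : ∀ᶠ h : 𝔸 in 𝓝 (g : 𝔸), Ring.inverse h * g ∈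
        {w : 𝔸 | ∃ a : 𝔸, ‖a - π a‖ < 1 ∧ IsUnit (1 + π a) ∧
          w = (1 + (a - π a)) * (1 + π a)} := by
      refine hcont.eventually_mem ?_
      rwa [Ring.inverse_unit, Units.inv_mul]
    have h2 : ∀ᶠ h : 𝔸 in 𝓝 (g : 𝔸), IsUnit h := Units.isOpen.mem_nhds g.isUnit
    obtain ⟨d, hdD, ⟨a, ha1, ⟨b, hb⟩, ha3⟩, ⟨d', rfl⟩⟩ :=
      hDd.inter_nhds_nonempty (h1.and h2)
    obtain ⟨u, hu⟩ := hunit _ ha1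
    have hg : g = d' * (u * b) := by
      ext
      rw [Ring.inverse_unit, ← hu, ← hb] at ha3
      rw [Units.val_mul, Units.val_mul, ← ha3, Units.mul_inv_cancel_left]
    have hbmem : (b : 𝔸) ∈ 𝔟 := by rw [hb]; exact add_mem (one_mem _) (hπ a)
    refine mem_iUnion₂.2 ⟨d', hdD, ⟨(⟨a - π a, ?_⟩, ⟨_, hW b hbmem t ht⟩), ha1, ?_⟩⟩
    · change π (a - π a) = 0
      rw [map_sub, hπ' _ (hπ a), sub_self]
    · simp only [Θ, ← hu, Ring.inverse_unit, conjCLE_apply, hg]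
      simp [mul_assoc]
  refine (dimH_mono hcover).trans ?_
  rw [dimH_bUnion hDc]
  refine iSup₂_le fun d _ => ?_
  refine (dimH_image_le_finrank (hΘ d) hsc subset_rfl).trans ?_
  rw [Module.finrank_prod, hN]

end ConjugationCharts

/-- A matrix whose commutator with a triangular matrix with distinct diagonal entries is triangular
is itself triangular. -/
theorem Matrix.blockTriangular_of_commutator {R ι α : Type*} [CommRing R] [IsDomain R] [Fintype ι]
    [LinearOrder α] {b : ι → α} (hb : Function.Injective b) {T x : Matrix ι ι R}
    (hT : T.BlockTriangular b) (hd : Function.Injective fun i => T i i)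
    (h : (x * T - T * x).BlockTriangular b) : x.BlockTriangular b := by
  classical
  by_contra hx
  have hne : (Finset.univ.filter fun p : ι × ι => b p.2 < b p.1 ∧ x p.1 p.2 ≠ 0).Nonempty := by
    by_contra hemp
    rw [Finset.not_nonempty_iff_eq_empty, Finset.filter_eq_empty_iff] at hemp
    refine hx fun i j hij => ?_
    by_contra h0
    exact hemp (Finset.mem_univ (i, j)) ⟨hij, h0⟩
  -- Take a nonzero entry below the diagonal in the first possible column and, there, the last row.
  -- All other terms of the commutator at this entry vanish, leaving `x p q * (T q q - T p p)`.
  obtain ⟨⟨p, q⟩, hpq, hmin⟩ := Finset.exists_min_image _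
    (fun p : ι × ι => toLex (b p.2, OrderDual.toDual (b p.1))) hne
  simp only [Finset.mem_filter, Finset.mem_univ, true_and] at hpq hmin
  have h1 : (x * T) p q = x p q * T q q := by
    rw [mul_apply, Finset.sum_eq_single q]
    · intro k _ hk
      rcases lt_or_gt_of_ne (hb.ne hk) with hlt | hlt
      · have : x p k = 0 := by
          by_contra h0
          have := hmin (p, k) ⟨hlt.trans hpq.1, h0⟩
          rw [Prod.Lex.toLex_le_toLex] at this
          rcases this with h' | h'
          · exact lt_asymm h' hlt
          · exact hlt.ne h'.1.symm
        rw [this, zero_mul]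
      · rw [hT hlt, mul_zero]
    · simp
  have h2 : (T * x) p q = T p p * x p q := by
    rw [mul_apply, Finset.sum_eq_single p]
    · intro k _ hk
      rcases lt_or_gt_of_ne (hb.ne hk) with hlt | hlt
      · rw [hT hlt, zero_mul]
      · have : x k q = 0 := by
          by_contra h0
          have := hmin (k, q) ⟨hpq.1.trans hlt, h0⟩
          rw [Prod.Lex.toLex_le_toLex] at this
          rcases this with h' | h'
          · exact lt_irrefl _ h'
          · exact not_le.2 hlt (OrderDual.toDual_le_toDual.1 h'.2)
        rw [this, mul_zero]
    · simp
  have h3 := h hpq.1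
  rw [sub_apply, h1, h2, mul_comm, ← sub_mul] at h3
  rcases mul_eq_zero.1 h3 with h0 | h0
  · have := hd (sub_eq_zero.1 h0)
    rw [this] at hpq
    exact lt_irrefl _ hpq.1
  · exact hpq.2 h0

/-- Dimension of the kernel of a linear map on a subspace that it maps onto its codomain. -/
theorem finrank_inf_ker_add {K E F : Type*} [Field K] [AddCommGroup E] [Module K E]
    [FiniteDimensional K E] [AddCommGroup F] [Module K F] (W : Submodule K E) (Λ : E →ₗ[K] F)
    (h : ∀ y, ∃ x ∈ W, Λ x = y) :
    Module.finrank K (W ⊓ LinearMap.ker Λ : Submodule K E) + Module.finrank K F =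
      Module.finrank K W := by
  have h1 := LinearMap.finrank_range_add_finrank_ker (Λ.domRestrict W)
  have h2 : LinearMap.range (Λ.domRestrict W) = ⊤ := LinearMap.range_eq_top.2 fun y => by
    obtain ⟨x, hx, rfl⟩ := h y
    exact ⟨⟨x, hx⟩, rfl⟩
  have h3 : W ⊓ LinearMap.ker Λ = (LinearMap.ker (Λ.domRestrict W)).map W.subtype := by
    ext x
    constructor
    · rintro ⟨h, h'⟩
      exact ⟨⟨x, h⟩, h', rfl⟩
    · rintro ⟨⟨x, h⟩, h', rfl⟩
      exact ⟨h, h'⟩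
  rw [h2, finrank_top] at h1
  rw [h3, Submodule.finrank_map_subtype_eq, add_comm, h1]

/-! ### Dimension counts -/

section Dimensions

variable {n : ℕ}

theorem finrank_quatMat (n : ℕ) : Module.finrank ℝ (QuatMat n) = 4 * n ^ 2 := by
  let e : QuatMat n ≃ₗ[ℝ] Matrix (Fin n) (Fin n) ℂ × Matrix (Fin n) (Fin n) ℂ :=
    { toFun := fun Z => ((Z : Matrix (Fin n ⊕ Fin n) (Fin n ⊕ Fin n) ℂ).toBlocks₁₁,
        (Z : Matrix (Fin n ⊕ Fin n) (Fin n ⊕ Fin n) ℂ).toBlocks₁₂)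
      map_add' := fun _ _ => rfl
      map_smul' := fun _ _ => rfl
      invFun := fun p => ⟨_, p.1, p.2, rfl⟩
      left_inv := by
        rintro ⟨_, X, Y, rfl⟩
        simp
      right_inv := fun p => by simp }
  rw [e.finrank_eq, Module.finrank_prod, Module.finrank_matrix, Complex.finrank_real_complex]
  simp
  ring

/-- The diagonal quaternionic matrix with complex entries `z`. -/
noncomputable def diagQuat (z : Fin n → ℂ) : QuatMat n :=
  ⟨Matrix.diagonal (Sum.elim z fun j => conj (z j)), mem_quatMat_iff.2 fun i j => by
    by_cases h : i = j <;> simp [h]⟩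

theorem diagQuat_mem (z : Fin n → ℂ) : diagQuat z ∈ quatTriangular n :=
  Matrix.blockTriangular_diagonal _

theorem quatDiag_diagQuat (z : Fin n → ℂ) (p : Fin n ⊕ Fin n) :
    quatDiag (diagQuat z) p = Sum.elim z (fun j => conj (z j)) p := Matrix.diagonal_apply_eq _ _

variable (n) in
/-- The real parts of the diagonal entries. -/
noncomputable def reDiag : QuatMat n →ₗ[ℝ] (Fin n → ℝ) where
  toFun T j := (quatDiag T (.inl j)).re
  map_add' _ _ := rfl
  map_smul' r T := by funext j; simp [quatDiag]

/-- The difference of the imaginary parts of two diagonal entries. -/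
noncomputable def imDiagSub (p q : Fin n ⊕ Fin n) : QuatMat n →ₗ[ℝ] ℝ where
  toFun T := (quatDiag T p).im - (quatDiag T q).im
  map_add' S T := by simp [quatDiag]; ring
  map_smul' r T := by simp [quatDiag]; ring

theorem reDiag_apply (T : QuatMat n) (j : Fin n) : reDiag n T j = (quatDiag T (.inl j)).re := rfl

theorem imDiagSub_apply (p q : Fin n ⊕ Fin n) (T : QuatMat n) :
    imDiagSub p q T = (quatDiag T p).im - (quatDiag T q).im := rfl

theorem reDiag_surjective_on (r : Fin n → ℝ) :
    ∃ T ∈ quatTriangular n, reDiag n T = r := by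
  refine ⟨diagQuat fun j => r j, diagQuat_mem _, ?_⟩
  funext j
  simp [reDiag_apply, quatDiag_diagQuat]

/-- The triangular matrices with imaginary diagonal and `p`-th and `q`-th diagonal entries equal. -/
noncomputable def repeatedTriangular (p q : Fin n ⊕ Fin n) : Submodule ℝ (QuatMat n) :=
  (quatTriangular n).toSubmodule ⊓ LinearMap.ker ((reDiag n).prod (imDiagSub p q))

theorem mem_repeatedTriangular {p q : Fin n ⊕ Fin n} {T : QuatMat n} :
    T ∈ repeatedTriangular p q ↔ T ∈ quatTriangular n ∧
      (∀ j : Fin n, (quatDiag T (.inl j)).re = 0) ∧ (quatDiag T p).im = (quatDiag T q).im := by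
  refine and_congr_right fun _ => ?_
  rw [SetLike.mem_coe, LinearMap.mem_ker, LinearMap.prod_apply, Function.prod_apply,
    Prod.mk_eq_zero, funext_iff, imDiagSub_apply, sub_eq_zero]
  rfl

theorem finrank_repeatedTriangular {p q : Fin n ⊕ Fin n} (hpq : p ≠ q) :
    Module.finrank ℝ (repeatedTriangular p q) + (n + 1) =
      Module.finrank ℝ (quatTriangular n) := by
  have h := finrank_inf_ker_add (E := QuatMat n) (quatTriangular n).toSubmodule
    ((reDiag n).prod (imDiagSub p q)) (by
    rintro ⟨r, s⟩
    -- Imaginary parts change sign on the `inr` half, so for the conjugate positions `inl j`, `inr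
    -- j` the difference is twice an entry; hence the halves.
    obtain ⟨y, hy⟩ : ∃ y : Fin n → ℝ, (Sum.elim y (fun j => -y j) p) -
        (Sum.elim y (fun j => -y j) q) = s := by
      rcases p with i | i <;> rcases q with j | j
      · have : j ≠ i := fun h => hpq (by rw [h])
        exact ⟨Pi.single i s, by simp [this]⟩
      · by_cases h : j = i
        · subst h; exact ⟨Pi.single j (s / 2), by simp⟩
        · exact ⟨Pi.single i s, by simp [h]⟩
      · by_cases h : j = i
        · subst h; exact ⟨Pi.single j (-s / 2), by simp; ring⟩
        · exact ⟨Pi.single i (-s), by simp [h]⟩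
      · have : j ≠ i := fun h => hpq (by rw [h])
        exact ⟨Pi.single i (-s), by simp [this]⟩
    refine ⟨diagQuat fun j => ⟨r j, y j⟩, diagQuat_mem _, Prod.ext ?_ ?_⟩
    · funext j
      simp [reDiag_apply, quatDiag_diagQuat]
    · rw [← hy]
      rcases p with i | i <;> rcases q with j | j <;>
        simp [imDiagSub_apply, quatDiag_diagQuat]
    )
  rw [Module.finrank_prod, Module.finrank_fin_fun, Module.finrank_self] at h
  exact h

theorem quatDiag_mul {S T : QuatMat n} (hS : S ∈ quatTriangular n) (hT : T ∈ quatTriangular n)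
    (p : Fin n ⊕ Fin n) : quatDiag (S * T) p = quatDiag S p * quatDiag T p :=
  Matrix.BlockTriangular.mul_diag quatKey_injective hS hT p

/-- Diagonal entries are multiplicative on triangular matrices, so conjugation by a triangular unit
leaves them unchanged. -/
theorem conjCLE_mem_repeatedTriangular {p q : Fin n ⊕ Fin n} (b : (QuatMat n)ˣ)
    (hb : (b : QuatMat n) ∈ quatTriangular n) (T : QuatMat n)
    (hT : T ∈ repeatedTriangular p q) : conjCLE b T ∈ repeatedTriangular p q := by
  have hb' : ((b⁻¹ : (QuatMat n)ˣ) : QuatMat n) ∈ quatTriangular n := by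
    obtain ⟨c, hc⟩ := (quatTriangular n).isUnit_of_isUnit_coe (a := ⟨b, hb⟩) b.isUnit
    have h1 : (b : QuatMat n) * ((c⁻¹ : (quatTriangular n)ˣ) : quatTriangular n) = 1 := by
      have := congrArg Subtype.val c.mul_inv
      rw [hc] at this
      exact this
    rw [Units.inv_eq_of_mul_eq_one_right h1]
    exact ((c⁻¹ : (quatTriangular n)ˣ) : quatTriangular n).2
  rw [mem_repeatedTriangular] at hT ⊢
  obtain ⟨h1, h2, h3⟩ := hT
  have hdiag : ∀ r, quatDiag (conjCLE b T) r = quatDiag T r := by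
    intro r
    rw [conjCLE_apply, quatDiag_mul (mul_mem hb h1) hb', quatDiag_mul hb h1, mul_right_comm,
      ← quatDiag_mul hb hb', Units.mul_inv]
    simp [quatDiag]
  refine ⟨mul_mem (mul_mem hb h1) hb', ?_, ?_⟩
  · simpa only [hdiag] using h2
  · rw [hdiag, hdiag]; exact h3

/-- Submanifolds consisting of matrices with a purely imaginary spectrum and a repeated eigenvalue
have small dimension. -/
theorem dim_lt_of_subset_repeated {d : ℕ} {S : Set (QuatMat n)} (hS : IsEmbeddedSubmanifold d S)
    (hne : S.Nonempty)
    (hsub : S ⊆ {A | HasPurelyImaginarySpectrum A ∧ ¬ HasNoRepeatedEigenvalues A}) :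
    d < 4 * n ^ 2 - n := by
  have hrep : ∀ A ∈ S, ∃ p q : Fin n ⊕ Fin n, p ≠ q ∧
      ∃ g : (QuatMat n)ˣ, ∃ T ∈ repeatedTriangular p q, A = conjCLE g T := by
    intro A hA
    obtain ⟨h1, h2⟩ := hsub hA
    obtain ⟨g, T, rfl, hT⟩ := exists_conj_blockTriangular A
    rw [hasNoRepeatedEigenvalues_conj_iff g hT] at h2
    rw [hasPurelyImaginarySpectrum_conj_iff g hT] at h1
    simp only [Function.Injective, not_forall] at h2
    obtain ⟨p, q, hpq, hne⟩ := h2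
    exact ⟨p, q, hne, g, T, mem_repeatedTriangular.2 ⟨hT, h1, by rw [hpq]⟩, rfl⟩
  obtain ⟨x, hx⟩ := hne
  -- A repetition needs an index. Positivity of `n` keeps the truncated subtraction below from
  -- spoiling the strict inequality.
  have hn : 1 ≤ n := by
    obtain ⟨p, -⟩ := hrep x hx
    rcases p with i | i <;> have := i.pos <;> omega
  have hle : (d : ENNReal) ≤ (4 * n ^ 2 - (n + 1) : ℕ) := by
    refine (IsEmbeddedAt.le_dimH (hS x hx) hx).trans ?_
    have hcover : S ⊆ ⋃ pq : {pq : (Fin n ⊕ Fin n) × (Fin n ⊕ Fin n) // pq.1 ≠ pq.2},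
        {A | ∃ g : (QuatMat n)ˣ, ∃ T ∈ repeatedTriangular pq.1.1 pq.1.2, A = conjCLE g T} := by
      intro A hA
      obtain ⟨p, q, hpq, h⟩ := hrep A hA
      exact mem_iUnion.2 ⟨⟨(p, q), hpq⟩, h⟩
    refine (dimH_mono hcover).trans ?_
    rw [dimH_iUnion]
    refine iSup_le fun pq => ?_
    refine (dimH_conjugates_le (𝔟 := quatTriangular n)
      (fun b hb T hT => conjCLE_mem_repeatedTriangular b hb T hT)).trans ?_
    rw [Nat.cast_le, finrank_quatMat]
    have h1 := finrank_repeatedTriangular pq.2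
    have h2 : Module.finrank ℝ (quatTriangular n) ≤ 4 * n ^ 2 := by
      rw [← finrank_quatMat n]
      exact Submodule.finrank_le (quatTriangular n).toSubmodule
    omega
  have hle' : d ≤ 4 * n ^ 2 - (n + 1) := by exact_mod_cast hle
  have : n + 1 ≤ 4 * n ^ 2 := by nlinarith
  omega

end Dimensions

/-! ### The stratum with simple spectrum -/

section GenericStratum

theorem complexPolyFun.continuous {E : Type*} [NormedAddCommGroup E] [NormedSpace ℝ E]
    (f : complexPolyFun E) : Continuous (f : E → ℂ) := by
  have h1 := polyFun.continuous ⟨_, f.2.1⟩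
  have h2 := polyFun.continuous ⟨_, f.2.2⟩
  have : (f : E → ℂ) = fun x => (((f : E → ℂ) x).re : ℂ) + (((f : E → ℂ) x).im : ℂ) * Complex.I :=
    funext fun x => (Complex.re_add_im _).symm
  rw [this]
  exact (Complex.continuous_ofReal.comp h1).add
    ((Complex.continuous_ofReal.comp h2).mul continuous_const)

variable {n : ℕ}

theorem isOpen_setOf_injective_quatDiag :
    IsOpen {T : QuatMat n | Function.Injective (quatDiag T)} := by
  have : {T : QuatMat n | Function.Injective (quatDiag T)} =
      ⋂ (p : Fin n ⊕ Fin n) (q : Fin n ⊕ Fin n) (_ : p ≠ q),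
        {T | quatDiag T p ≠ quatDiag T q} := by
    ext T
    simp only [mem_ofPred_eq, mem_iInter]
    exact ⟨fun h p q hpq => h.ne hpq, fun h p q => not_imp_not.1 (h p q)⟩
  rw [this]
  have hcont : ∀ p, Continuous fun T : QuatMat n => quatDiag T p := fun p =>
    complexPolyFun.continuous (genericQuatMat n p p)
  exact isOpen_iInter_of_finite fun p => isOpen_iInter_of_finite fun q =>
    isOpen_iInter_of_finite fun _ => isOpen_ne_fun (hcont p) (hcont q)

/-- In the conjugation chart the only equations are the vanishing of the `n` real parts on the
diagonal of the triangular component; simplicity of the spectrum is open and gives the regularity of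
`T`. -/
theorem isEmbeddedSubmanifold_noRepeated (n : ℕ) : IsEmbeddedSubmanifold (4 * n ^ 2 - n)
    {A : QuatMat n | HasPurelyImaginarySpectrum A ∧ HasNoRepeatedEigenvalues A} := by
  rintro A ⟨h1, h2⟩
  obtain ⟨g, T, rfl, hT⟩ := exists_conj_blockTriangular A
  rw [hasNoRepeatedEigenvalues_conj_iff g hT] at h2
  obtain ⟨π, hπ, hπ'⟩ := exists_projection (quatTriangular n)
  let Λ : QuatMat n →ₗ[ℝ] (Fin n → ℝ) := (reDiag n).comp (π : QuatMat n →ₗ[ℝ] QuatMat n)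
  have hΛ : Function.Surjective Λ := by
    intro r
    obtain ⟨D, hD, hDr⟩ := reDiag_surjective_on r
    exact ⟨D, by rw [← hDr, ← hπ' D hD]; simp [Λ, hπ' _ (hπ _)]⟩
  have hdim : Module.finrank ℝ (LinearMap.ker Λ) = 4 * n ^ 2 - n := by
    have := LinearMap.finrank_range_add_finrank_ker Λ
    rw [LinearMap.range_eq_top.2 hΛ, finrank_top, Module.finrank_fin_fun, finrank_quatMat] at this
    omega
  rw [← hdim]
  refine isEmbeddedAt_conj hπ hπ' hT (fun x hx => ?_) isOpen_setOf_injective_quatDiag h2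
    (LinearMap.ker Λ) (fun C t ht htU => ?_) (fun a => ?_) g
  · exact Matrix.blockTriangular_of_commutator quatKey_injective hT h2 hx
  · have e : conjCLE C t = C * t * (C⁻¹ : (QuatMat n)ˣ) := rfl
    rw [mem_ofPred_eq, e, hasPurelyImaginarySpectrum_conj_iff C ht,
      hasNoRepeatedEigenvalues_conj_iff C ht, LinearMap.mem_ker]
    have : Λ t = reDiag n t := by
      change reDiag n (π t) = _
      rw [hπ' t ht]
    rw [this, funext_iff]
    exact ⟨fun h => h.1, fun h => ⟨h, htU⟩⟩
  · rw [LinearMap.mem_ker, LinearMap.mem_ker]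
    have : Λ (π a) = Λ a := by
      change reDiag n (π (π a)) = reDiag n (π a)
      rw [hπ' _ (hπ a)]
    rw [this]

theorem nonempty_noRepeated (n : ℕ) :
    {A : QuatMat n | HasPurelyImaginarySpectrum A ∧ HasNoRepeatedEigenvalues A}.Nonempty := by
  -- The shift by one keeps the eigenvalues off `0`, where they would coincide with their
  -- conjugates.
  let z : Fin n → ℂ := fun j => ⟨0, (j : ℝ) + 1⟩
  have hz := diagQuat_mem z
  have hconj : (((1 : (QuatMat n)ˣ) : QuatMat n) * diagQuat z *
      ((1 : (QuatMat n)ˣ)⁻¹ : (QuatMat n)ˣ)) = diagQuat z := by simp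
  refine ⟨diagQuat z, ?_, ?_⟩
  · rw [← hconj, hasPurelyImaginarySpectrum_conj_iff 1 hz]
    intro j
    simp [quatDiag_diagQuat, z]
  · rw [← hconj, hasNoRepeatedEigenvalues_conj_iff 1 hz]
    intro p q hpq
    rw [quatDiag_diagQuat, quatDiag_diagQuat] at hpq
    have him := congrArg Complex.im hpq
    rcases p with i | i <;> rcases q with j | j <;> simp [z] at him
    · rw [Fin.ext him]
    · have := (Nat.cast_nonneg (α := ℝ) (i : ℕ)); have := (Nat.cast_nonneg (α := ℝ) (j : ℕ))
      linarith
    · have := (Nat.cast_nonneg (α := ℝ) (i : ℕ)); have := (Nat.cast_nonneg (α := ℝ) (j : ℕ))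
      linarith
    · rw [Fin.ext him]

end GenericStratum

end

/-! ### Assembling the strata -/

theorem theorem7p12 (n : ℕ) :
    ∃ (k : ℕ) (S : Fin k → Set (QuatMat n)) (d : Fin k → ℕ),
      (∀ j, (S j).Nonempty) ∧
      (∀ j, IsEmbeddedSubmanifold (d j) (S j)) ∧
      (∀ j, IsConjugacyInvariant (S j)) ∧
      (∀ i j, i ≠ j → Disjoint (S i) (S j)) ∧
      (⋃ j, S j) = {A : QuatMat n | HasPurelyImaginarySpectrum A} ∧
      ∃ j₀, d j₀ = 4 * n ^ 2 - n ∧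
        S j₀ = {A : QuatMat n | HasPurelyImaginarySpectrum A ∧ HasNoRepeatedEigenvalues A} ∧
        ∀ j, j ≠ j₀ → d j < 4 * n ^ 2 - n := by
  obtain ⟨ι, hι, S, d, h1, h2, h3, h4⟩ := hasStratification_repeated n
  let G : Set (QuatMat n) := {A | HasPurelyImaginarySpectrum A ∧ HasNoRepeatedEigenvalues A}
  have hsub : ∀ i, S i ⊆ {A | HasPurelyImaginarySpectrum A ∧ ¬ HasNoRepeatedEigenvalues A} :=
    fun i => h4 ▸ Set.subset_iUnion S i
  have hG : ∀ i, Disjoint G (S i) := fun i =>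
    Set.disjoint_left.2 fun A hA hA' => (hsub i hA').2 hA.2
  -- `none` stands for the simple-spectrum stratum; empty strata of the repeated part are discarded.
  let κ := Option {i : ι // (S i).Nonempty}
  let S' : κ → Set (QuatMat n) := fun o => o.elim G fun i => S i
  let d' : κ → ℕ := fun o => o.elim (4 * n ^ 2 - n) fun i => d i
  let e : Fin (Nat.card κ) ≃ κ := (Finite.equivFin κ).symm
  have hdisj : ∀ i j, i ≠ j → Disjoint (S' i) (S' j) := by
    rintro (_ | i) (_ | j) hij
    · exact absurd rfl hij
    · exact hG j
    · exact (hG i).symm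
    · exact h3 _ _ fun h => hij (by rw [Subtype.ext h])
  have hne : ∀ o, (S' o).Nonempty := by
    rintro (_ | i)
    · exact nonempty_noRepeated n
    · exact i.2
  have hemb : ∀ o, IsEmbeddedSubmanifold (d' o) (S' o) := by
    rintro (_ | i)
    · exact isEmbeddedSubmanifold_noRepeated n
    · exact h1 i
  have hinv : ∀ o, IsConjugacyInvariant (S' o) := by
    rintro (_ | i)
    · intro C A hA
      exact ⟨(hasPurelyImaginarySpectrum_conj C A).2 hA.1,
        (hasNoRepeatedEigenvalues_conj C A).2 hA.2⟩
    · exact isStable_range_conjCLE.1 (h2 i)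
  refine ⟨Nat.card κ, fun j => S' (e j), fun j => d' (e j), fun j => hne _, fun j => hemb _,
    fun j => hinv _, fun i j hij => hdisj _ _ (e.injective.ne hij), ?_, e.symm none, ?_, ?_,
    fun j hj => ?_⟩
  · rw [e.surjective.iUnion_comp S']
    ext A
    simp only [Set.mem_iUnion, Set.mem_ofPred_eq]
    constructor
    · rintro ⟨_ | i, hA⟩
      · exact hA.1
      · exact (hsub i hA).1
    · intro hA
      by_cases hr : HasNoRepeatedEigenvalues A
      · exact ⟨none, hA, hr⟩
      · have : A ∈ ⋃ i, S i := by rw [h4]; exact ⟨hA, hr⟩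
        obtain ⟨i, hi⟩ := Set.mem_iUnion.1 this
        exact ⟨some ⟨i, A, hi⟩, hi⟩
  · simp [d']
  · simp only [Equiv.apply_symm_apply]
    rfl
  · have hj' : e j ≠ none := fun h => hj (by rw [← h, e.symm_apply_apply])
    obtain ⟨i, hi⟩ := Option.ne_none_iff_exists'.1 hj'
    simp only [hi]
    exact dim_lt_of_subset_repeated (h1 i) i.2 (hsub i)
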